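/- Let $\{X_t\}_{t\in\mathbb Z}$ be a centered, second-order stationary real process on a probability space, with $\mathrm{var}\,X_0>0$, and let $\{h_k\}_{k\in\mathbb Z}$ be real. Write $\|Z\|^2=\mathbb E[Z^2]$, let $V_{(-\infty,n]}$ be the closed linear span of $\{X_t:t\le n\}$ in $L^2$, and call $\{X_t\}$ purely nondeterministic if $\bigcap_{n}V_{(-\infty,n]}=\{0\}$. Let $\varepsilon_t=X_t-P_{(-\infty,t-1]}X_t$ be the innovations, $\psi_j$ (with $\psi_0=1$) the coefficients in the Wold decomposition $X_t=\sum_{j\ge0}\psi_j\varepsilon_{t-j}$, and define $\phi_j$ (with $\phi_0=-1$) by the formal power series identity $1-\sum_{j\ge1}\phi_jz^j=\big(\sum_{j\ge0}\psi_jz^j\big)^{-1}$. Consider the conditions * (SM$_\alpha$): $\{X_t\}$ is purely nondeterministic, $\sum_{j\ge0}(1+j)^\alpha|\psi_j|<\infty$ and $\sum_{j\ge0}(1+j)^\alpha|\phi_j|<\infty$; * (LM$_d$): $\{X_t\}$ is purely nondeterministic and, for some slowly varying function $\ell$ (positive and measurable on $[0,\infty)$, with $\ell(\lambda x)/\ell(x)\to1$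 as $x\to\infty$ for every $\lambda>0$), $\psi_j\sim j^{-(1-d)}\ell(j)$ and $\phi_j\sim j^{-(1+d)}\frac{1}{\ell(j)}\frac{d\sin(\pi d)}{\pi}$ as $j\to\infty$; and assume that one of the following holds: * (H-SM1): (SM$_\alpha$) for some $\alpha\ge0$, and $\sum_{k\in\mathbb Z}|h_k|<\infty$; * (H-SM2): (SM$_\alpha$) for some $\alpha\ge1$, and $\sum_{k\in\mathbb Z}|h_k|^2<\infty$; * (H-LM): (LM$_d$) for some $d\in(0,1/2)$, and $\sum_{k\in\mathbb Z}(1+|k|)^d|h_k|<\infty$. Then for every $n\ge1$ the target $Y_n=\sum_{k\in\mathbb Z}h_kX_{n-k}$ converges in $L^2$. The following coefficients exist and are unique, those in (a) not depending on $n\ge 1$: (a) $\{\hat h_k\}_{k\ge1}$, respectively $\{\phi_k^m\}_{k\ge1}$ for $m\ge1$, minimizing $\|Z-\sum_{k=1}^\infty a_kX_{n+1-k}\|^2$ over all real sequences $(a_k)_{k\ge1}$ for which the series converges in $L^2$, where $Z=Y_n$, respectively $Z=X_{n+m}$; (b) $\{\hat h_{k,n}\}_{k=1}^n$, respectively $\{\phi_{k,n}^m\}_{k=1}^n$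 for $m\ge1$, minimizing $\|Z-\sum_{k=1}^na_kX_{n+1-k}\|^2$ over $(a_1,\dots,a_n)\in\mathbb R^n$, where $Z=Y_n$, respectively $Z=X_{n+m}$. Moreover, $$\hat h_k=\sum_{m=1}^\infty h_{-m}\phi_k^m+h_{k-1},\qquad k\ge1,$$ $$\hat h_{k,n}=\sum_{m=1}^\infty h_{-m}\phi_{k,n}^m+h_{k-1}+\sum_{m=1}^\infty h_{n-1+m}\,\phi_{n+1-k,n}^m,\qquad n\ge1,\ 1\le k\le n,$$ and all these series converge absolutely. Finally, $\sum_{k\ge1}|\hat h_k|<\infty$ under (H-SM1) or (H-LM), and $\sum_{k\ge1}|\hat h_k|^2<\infty$ under (H-SM2). -/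

import Mathlib

open MeasureTheory ProbabilityTheory Filter Topology Asymptotics
open scoped NNReal

noncomputable section

/-! ### Linear prediction of a sequence `x : ℤ → E` in a real Hilbert space

Below, `E` is `L²(Ω, P)` and `x t` is the class of the random variable `X t`. -/

section Hilbert

variable {E : Type*} [NormedAddCommGroup E] [InnerProductSpace ℝ E] [CompleteSpace E]

/-- The closed linear span of `x t`, `t ≤ n`. -/
abbrev pastSpan (x : ℤ → E) (n : ℤ) : Submodule ℝ E :=
  (Submodule.span ℝ (x '' Set.Iic n)).topologicalClosure

/-- The intersection of the pasts is trivial. -/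
def IsPurelyNondeterministic (x : ℤ → E) : Prop :=
  ⨅ n : ℤ, pastSpan x n = ⊥

/-- The white noise of the Wold decomposition: `ε_t = x_t - P_{(-∞, t-1]} x_t`. -/
def innovation (x : ℤ → E) (t : ℤ) : E :=
  x t - (pastSpan x (t - 1)).starProjection (x t)

/-- The infinite-order moving average coefficients `ψ_j`, i.e. the coefficients in the Wold
decomposition `x_t = ∑_{j ≥ 0} ψ_j ε_{t-j}` (read off at `t = 0`; they do not depend on `t` for
a stationary sequence). In particular `ψ_0 = 1` when the innovations do not vanish. -/
def maCoeff (x : ℤ → E) (j : ℕ) : ℝ :=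
  inner ℝ (x 0) (innovation x (-(j : ℤ))) / ‖innovation x (-(j : ℤ))‖ ^ 2

/-- The infinite-order autoregressive coefficients `φ_j`, given by
`1 - ∑_{j ≥ 1} φ_j z^j = (∑_{j ≥ 0} ψ_j z^j)⁻¹`, with `φ_0 = -1`. -/
def arCoeff (x : ℤ → E) (j : ℕ) : ℝ :=
  -PowerSeries.coeff j (PowerSeries.mk (maCoeff x))⁻¹

/-- `a` minimizes `‖y - ∑_{k ≥ 1} a_k x_{n+1-k}‖²` among all real sequences whose series
converges. The entry `a 0` plays no role. -/
def IsInfMinimizer (x : ℤ → E) (n : ℤ) (y : E) (a : ℕ → ℝ) : Prop :=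
  ∃ w : E, Tendsto (fun N : ℕ => ∑ k ∈ Finset.Icc 1 N, a k • x (n + 1 - k)) atTop (𝓝 w) ∧
    ∀ (b : ℕ → ℝ) (v : E),
      Tendsto (fun N : ℕ => ∑ k ∈ Finset.Icc 1 N, b k • x (n + 1 - k)) atTop (𝓝 v) →
        ‖y - w‖ ^ 2 ≤ ‖y - v‖ ^ 2

/-- `a_1, …, a_n` minimize `‖y - ∑_{k=1}^n a_k x_{n+1-k}‖²`. The other entries of `a` play no
role. -/
def IsFinMinimizer (x : ℤ → E) (n : ℕ) (y : E) (a : ℕ → ℝ) : Prop :=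
  ∀ b : ℕ → ℝ,
    ‖y - ∑ k ∈ Finset.Icc 1 n, a k • x (n + 1 - k)‖ ^ 2 ≤
      ‖y - ∑ k ∈ Finset.Icc 1 n, b k • x (n + 1 - k)‖ ^ 2

/-- The best linear predictor coefficients of the targets `Y n`, `n ≥ 1`, given `x t`, `t ≤ n`
(the same coefficients for all `n`). -/
def infCoeff (x : ℤ → E) (Y : ℕ → E) : ℕ → ℝ :=
  Classical.epsilon fun a : ℕ → ℝ => ∀ n : ℕ, 1 ≤ n → IsInfMinimizer x n (Y n) a

/-- The best linear predictor coefficients of `y` given `x 1, …, x n`. -/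
def finCoeff (x : ℤ → E) (n : ℕ) (y : E) : ℕ → ℝ :=
  Classical.epsilon fun a : ℕ → ℝ => IsFinMinimizer x n y a

/-- The `m`-step ahead infinite predictor coefficients `φ_k^m`. -/
def stepCoeff (x : ℤ → E) (m k : ℕ) : ℝ :=
  infCoeff x (fun n => x (n + m)) k

/-- The `m`-step ahead finite predictor coefficients `φ_{k,n}^m`. -/
def finStepCoeff (x : ℤ → E) (n m k : ℕ) : ℝ :=
  finCoeff x n (x (n + m)) k

/-- The target `Y_n = ∑_{k ∈ ℤ} h_k x_{n-k}`. -/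
def target (x : ℤ → E) (h : ℤ → ℝ) (n : ℕ) : E :=
  ∑' k : ℤ, h k • x (n - k)

/-- The coefficients `ĥ_k` of the best linear predictor of `Y_n` given `x t`, `t ≤ n`. -/
def hHat (x : ℤ → E) (h : ℤ → ℝ) (k : ℕ) : ℝ :=
  infCoeff x (target x h) k

/-- The coefficients `ĥ_{k,n}` of the best linear predictor of `Y_n` given `x 1, …, x n`. -/
def hHatFin (x : ℤ → E) (h : ℤ → ℝ) (n k : ℕ) : ℝ :=
  finCoeff x n (target x h n) k

/-- A positive measurable function on `[0, ∞)` that varies slowly at infinity. -/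
structure IsSlowlyVarying (l : ℝ≥0 → ℝ) : Prop where
  pos : ∀ s, 0 < l s
  measurable : Measurable l
  tendsto : ∀ c : ℝ≥0, 0 < c → Tendsto (fun s => l (c * s) / l s) atTop (𝓝 1)

/-- The short memory condition (SM_α). -/
def ShortMemory (x : ℤ → E) (α : ℝ) : Prop :=
  IsPurelyNondeterministic x ∧
    Summable (fun j : ℕ => (1 + (j : ℝ)) ^ α * |maCoeff x j|) ∧
    Summable (fun j : ℕ => (1 + (j : ℝ)) ^ α * |arCoeff x j|)

/-- The long memory condition (LM_d). -/
def LongMemory (x : ℤ → E) (d : ℝ) : Prop :=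
  IsPurelyNondeterministic x ∧ ∃ l : ℝ≥0 → ℝ, IsSlowlyVarying l ∧
    (fun j : ℕ => maCoeff x j) ~[atTop] (fun j : ℕ => (j : ℝ) ^ (-(1 - d)) * l j) ∧
    (fun j : ℕ => arCoeff x j) ~[atTop]
      (fun j : ℕ => (j : ℝ) ^ (-(1 + d)) * (1 / l j) * (d * Real.sin (Real.pi * d) / Real.pi))

/-- (H-SM1) -/
def HSM1 (x : ℤ → E) (h : ℤ → ℝ) : Prop :=
  (∃ α : ℝ, 0 ≤ α ∧ ShortMemory x α) ∧ Summable (fun k : ℤ => |h k|)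

/-- (H-SM2) -/
def HSM2 (x : ℤ → E) (h : ℤ → ℝ) : Prop :=
  (∃ α : ℝ, 1 ≤ α ∧ ShortMemory x α) ∧ Summable (fun k : ℤ => |h k| ^ 2)

/-- (H-LM) -/
def HLM (x : ℤ → E) (h : ℤ → ℝ) : Prop :=
  ∃ d : ℝ, 0 < d ∧ d < 1 / 2 ∧ LongMemory x d ∧
    Summable (fun k : ℤ => (1 + |(k : ℝ)|) ^ d * |h k|)

end Hilbert

section Probability

variable {Ω : Type*} [MeasurableSpace Ω]

/-- Centered second-order stationary processes. -/
structure IsCenteredStationary (X : ℤ → Ω → ℝ) (P : Measure Ω) : Prop where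
  memLp : ∀ t, MemLp (X t) 2 P
  centered : ∀ t, ∫ ω, X t ω ∂P = 0
  stationary : ∀ s t, cov[X (s + t), X t; P] = cov[X s, X 0; P]

/-- The process as a sequence in `L²(Ω, P)`. -/
def IsCenteredStationary.toL2 {X : ℤ → Ω → ℝ} {P : Measure Ω}
    (hX : IsCenteredStationary X P) (t : ℤ) : Lp ℝ 2 P :=
  (hX.memLp t).toLp (X t)

end Probability

end

/-! Each best predictor is an orthogonal projection in `L²`. Projections are linear and continuous,
so they may be applied term by term to the series defining the target; the formulas then follow by
comparing coefficients.

Infinite past. Under pure nondeterminism the innovations are orthogonal and total in each past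
(`eq_zero_of_inner_innovation`), so vectors of a past can be compared by pairing them with
innovations. When `φ` is absolutely summable this yields the autoregressive equation
(`hasSum_arCoeff`). Convolving it with `ψ` writes every multi-step projection as a series in the
past with coefficients `predictorCoeff` (`hasSum_predictorCoeff`). Expansions in the past are unique
(`eq_zero_of_tendsto_zero`), which identifies the minimizers. In the target, the terms up to time
`n` are fixed by the projection and each future term becomes such a series. Collecting the
coefficient of each past variable exchanges two sums, which is allowed once `h_{-m} φ_k^m` is
absolutely summable over `(m, k)`.

The three conditions serve to secure this double summability and the convergence of the target. The
`ℓ¹` norm of the predictor coefficients is at most `predictorBound`, the convolution of `|ψ|` with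
the tails of `|φ|`. It is bounded under short memory, summable when the weight is `α ≥ 1`, and `O(m
^ d)` under long memory. These cases match `h` summable, square summable (hence bounded), and
summable with weight `d`.

Finite past. The observed variables are linearly independent, so the coefficients are continuous
linear functionals of the target (`exists_isFinMinimizer_iff`). Terms inside the window predict
themselves, and terms before it are handled by time reversal (`finCoeff_reflect`). -/

open Finset.HasAntidiagonal (antidiagonal mem_antidiagonal)

/-! ### Innovations, Wold coefficients and expansions in the past -/

section Wold

variable {E : Type*} [NormedAddCommGroup E] [InnerProductSpace ℝ E]

/-- Inner products of a sequence depend only on the lag. -/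
def IsStationarySeq (x : ℤ → E) : Prop :=
  ∀ s t : ℤ, inner ℝ (x (s + t)) (x t) = inner ℝ (x s) (x 0)

theorem IsStationarySeq.inner_add {x : ℤ → E} (hx : IsStationarySeq x) (s t u : ℤ) :
    inner ℝ (x (s + u)) (x (t + u)) = inner ℝ (x s) (x t) := by
  have h1 := hx (s - t) (t + u)
  have h2 := hx (s - t) t
  rw [show s - t + (t + u) = s + u by ring] at h1
  rw [show s - t + t = s by ring] at h2
  rw [h1, h2]

/-- A real autocovariance is even in the lag, so time reversal preserves Gram matrices. This is the
source of the reversed coefficients in the finite-past formula. -/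
theorem IsStationarySeq.inner_reflect {x : ℤ → E} (hx : IsStationarySeq x) (s t u : ℤ) :
    inner ℝ (x (u - s)) (x (u - t)) = inner ℝ (x s) (x t) := by
  rw [real_inner_comm, ← hx.inner_add s t (u - s - t)]
  congr 2 <;> ring

/-- The squared norm is a quadratic form in the Gram matrix. Shift and reflection thus act
isometrically on finite combinations, with no operator to construct. -/
theorem norm_sum_smul_eq_of_gram {ι : Type*} {y z : ι → E} (s : Finset ι)
    (h : ∀ i ∈ s, ∀ j ∈ s, inner ℝ (y i) (y j) = inner ℝ (z i) (z j)) (c : ι → ℝ) :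
    ‖∑ i ∈ s, c i • y i‖ = ‖∑ i ∈ s, c i • z i‖ := by
  rw [← sq_eq_sq₀ (norm_nonneg _) (norm_nonneg _), ← real_inner_self_eq_norm_sq,
    ← real_inner_self_eq_norm_sq]
  simp only [sum_inner, inner_sum, real_inner_smul_left, real_inner_smul_right]
  exact Finset.sum_congr rfl fun i hi => Finset.sum_congr rfl fun j hj => by rw [h j hj i hi]

theorem IsStationarySeq.norm_eq {x : ℤ → E} (hx : IsStationarySeq x) (t : ℤ) : ‖x t‖ = ‖x 0‖ := by
  rw [← sq_eq_sq₀ (norm_nonneg _) (norm_nonneg _), ← real_inner_self_eq_norm_sq,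
    ← real_inner_self_eq_norm_sq]
  simpa using hx 0 t

theorem mem_pastSpan (x : ℤ → E) {t n : ℤ} (h : t ≤ n) : x t ∈ pastSpan x n :=
  Submodule.le_topologicalClosure _ (Submodule.subset_span ⟨t, h, rfl⟩)

theorem pastSpan_le_iff {x : ℤ → E} {n : ℤ} {K : Submodule ℝ E} (hK : IsClosed (K : Set E)) :
    pastSpan x n ≤ K ↔ ∀ t ≤ n, x t ∈ K := by
  refine ⟨fun h t ht => h (mem_pastSpan x ht), fun h => ?_⟩
  refine Submodule.topologicalClosure_minimal _ (Submodule.span_le.2 ?_) hK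
  rintro _ ⟨t, ht, rfl⟩
  exact h t ht

theorem isClosed_pastSpan (x : ℤ → E) (n : ℤ) : IsClosed (pastSpan x n : Set E) :=
  Submodule.isClosed_topologicalClosure _

theorem pastSpan_mono (x : ℤ → E) {m n : ℤ} (h : m ≤ n) : pastSpan x m ≤ pastSpan x n :=
  (pastSpan_le_iff (isClosed_pastSpan x n)).2 fun _ ht => mem_pastSpan x (ht.trans h)

theorem inner_eq_zero_of_mem_pastSpan {x : ℤ → E} {n : ℤ} {u v : E}
    (h : ∀ t ≤ n, inner ℝ u (x t) = 0) (hv : v ∈ pastSpan x n) : inner ℝ u v = 0 := by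
  have : pastSpan x n ≤ (Submodule.span ℝ {u})ᗮ := by
    refine (pastSpan_le_iff (Submodule.isClosed_orthogonal _)).2 fun t ht => ?_
    rw [Submodule.mem_orthogonal_singleton_iff_inner_right]
    exact h t ht
  exact (Submodule.mem_orthogonal_singleton_iff_inner_right).1 (this hv)

variable [CompleteSpace E]

theorem innovation_mem (x : ℤ → E) (t : ℤ) : innovation x t ∈ pastSpan x t :=
  Submodule.sub_mem _ (mem_pastSpan x le_rfl)
    (pastSpan_mono x (by lia) (Submodule.starProjection_apply_mem _ _))

theorem inner_innovation_of_mem (x : ℤ → E) (t : ℤ) {v : E} (hv : v ∈ pastSpan x (t - 1)) :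
    inner ℝ (innovation x t) v = 0 :=
  Submodule.starProjection_inner_eq_zero _ _ hv

theorem inner_innovation_of_lt (x : ℤ → E) {s t : ℤ} (h : s < t) :
    inner ℝ (x s) (innovation x t) = 0 := by
  rw [real_inner_comm]
  exact inner_innovation_of_mem x t (mem_pastSpan x (by lia))

theorem inner_self_innovation (x : ℤ → E) (t : ℤ) :
    inner ℝ (x t) (innovation x t) = ‖innovation x t‖ ^ 2 := by
  have h : x t = innovation x t + (pastSpan x (t - 1)).starProjection (x t) := by
    simp [innovation]
  conv_lhs => rw [h]
  rw [inner_add_left, real_inner_self_eq_norm_sq, real_inner_comm (innovation x t),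
    inner_innovation_of_mem x t (Submodule.starProjection_apply_mem _ _), add_zero]

theorem innovation_inner_innovation (x : ℤ → E) {s t : ℤ} (h : s ≠ t) :
    inner ℝ (innovation x s) (innovation x t) = 0 := by
  rcases lt_or_gt_of_ne h with h | h
  · rw [real_inner_comm]
    exact inner_innovation_of_mem x t (pastSpan_mono x (by lia) (innovation_mem x s))
  · exact inner_innovation_of_mem x s (pastSpan_mono x (by lia) (innovation_mem x t))

/-- Shifting the process shifts the innovations. -/
theorem IsStationarySeq.inner_innovation {x : ℤ → E} (hx : IsStationarySeq x) (s t : ℤ) :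
    inner ℝ (x (s + t)) (innovation x t) = inner ℝ (x s) (innovation x 0) := by
  set v := (pastSpan x (0 - 1)).starProjection (x 0) with hv
  have hvm : v ∈ closure (Submodule.span ℝ (x '' Set.Iic (0 - 1)) : Set E) := by
    rw [← Submodule.topologicalClosure_coe]
    exact Submodule.starProjection_apply_mem _ _
  obtain ⟨u, hu, hlim⟩ := mem_closure_iff_seq_limit.1 hvm
  have hu' : ∀ N, ∃ c : ℤ →₀ ℝ, c ∈ Finsupp.supported ℝ ℝ (Set.Iic (0 - 1 : ℤ)) ∧
      Finsupp.linearCombination ℝ x c = u N := fun N =>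
    (Finsupp.mem_span_image_iff_linearCombination ℝ).1 (hu N)
  choose c hc hcu using hu'
  have hnorm : ∀ c : ℤ →₀ ℝ, ‖Finsupp.linearCombination ℝ (fun i => x (i + t)) c‖ =
      ‖Finsupp.linearCombination ℝ x c‖ := fun c => by
    rw [Finsupp.linearCombination_apply, Finsupp.linearCombination_apply]
    exact norm_sum_smul_eq_of_gram _ (fun i _ j _ => hx.inner_add i j t) _
  -- Shift the finite combinations approximating the projection at time 0. They stay Cauchy by
  -- isometry, and their limit turns out to be the projection at time `t`.
  set w : ℕ → E := fun N => Finsupp.linearCombination ℝ (fun i => x (i + t)) (c N) with hw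
  have hcau : CauchySeq w := by
    have h1 := hlim.cauchySeq
    rw [Metric.cauchySeq_iff] at h1 ⊢
    intro ε hε
    obtain ⟨N, hN⟩ := h1 ε hε
    refine ⟨N, fun m hm n hn => ?_⟩
    have := hN m hm n hn
    rw [dist_eq_norm, ← hcu, ← hcu, ← map_sub] at this
    rwa [dist_eq_norm, hw, ← map_sub, hnorm]
  obtain ⟨w', hw'⟩ := cauchySeq_tendsto_of_complete hcau
  have hinner : ∀ r, inner ℝ (x (r + t)) w' = inner ℝ (x r) v := by
    intro r
    have h1 : Tendsto (fun N => inner ℝ (x (r + t)) (w N)) atTop (𝓝 (inner ℝ (x (r + t)) w')) :=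
      tendsto_const_nhds.inner hw'
    have h2 : Tendsto (fun N => inner ℝ (x r) (u N)) atTop (𝓝 (inner ℝ (x r) v)) :=
      tendsto_const_nhds.inner hlim
    refine tendsto_nhds_unique h1 (h2.congr fun N => ?_)
    simp only [← hcu, hw, Finsupp.linearCombination_apply, Finsupp.sum]
    simp only [inner_sum, real_inner_smul_right, hx.inner_add]
  have hmem : w' ∈ pastSpan x (t - 1) := by
    refine (isClosed_pastSpan x (t - 1)).mem_of_tendsto hw' (Eventually.of_forall fun N => ?_)
    simp only [hw, Finsupp.linearCombination_apply]
    refine Submodule.sum_mem _ fun i hi => Submodule.smul_mem _ _ (mem_pastSpan x ?_)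
    have : i ∈ Set.Iic (0 - 1 : ℤ) := hc N hi
    simp only [Set.mem_Iic] at this
    lia
  have hproj : (pastSpan x (t - 1)).starProjection (x t) = w' := by
    refine Submodule.eq_starProjection_of_mem_of_inner_eq_zero hmem fun z hz => ?_
    refine inner_eq_zero_of_mem_pastSpan (fun r hr => ?_) hz
    have h3 : inner ℝ (x 0 - v) (x (r - t)) = 0 :=
      Submodule.starProjection_inner_eq_zero _ _ (mem_pastSpan x (by lia))
    have h4 := hinner (r - t)
    have h5 := hx.inner_add 0 (r - t) t
    rw [sub_add_cancel] at h4 h5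
    rw [zero_add] at h5
    rw [inner_sub_left] at h3 ⊢
    linarith [real_inner_comm w' (x r), real_inner_comm v (x (r - t))]
  have h5 := hx.inner_add s 0 t
  rw [zero_add] at h5
  rw [innovation, innovation, hproj, inner_sub_right, inner_sub_right, hinner, h5]

theorem IsStationarySeq.norm_innovation {x : ℤ → E} (hx : IsStationarySeq x) (t : ℤ) :
    ‖innovation x t‖ = ‖innovation x 0‖ := by
  rw [← sq_eq_sq₀ (norm_nonneg _) (norm_nonneg _), ← inner_self_innovation,
    ← inner_self_innovation]
  simpa using hx.inner_innovation 0 t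

/-- If one innovation vanished, all would by stationarity; all the pasts would then coincide and `x
0` would lie in their trivial intersection. -/
theorem IsStationarySeq.innovation_ne_zero {x : ℤ → E} (hx : IsStationarySeq x)
    (hp : IsPurelyNondeterministic x) (h0 : x 0 ≠ 0) (t : ℤ) : innovation x t ≠ 0 := by
  intro hε
  have hε0 : ∀ s, innovation x s = 0 := fun s => by
    rw [← norm_eq_zero, hx.norm_innovation, ← hx.norm_innovation t, hε, norm_zero]
  have hstep : ∀ s, x s ∈ pastSpan x (s - 1) := fun s => by
    rw [sub_eq_zero.1 (hε0 s)]
    exact Submodule.starProjection_apply_mem _ _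
  have hle : ∀ s, pastSpan x s ≤ pastSpan x (s - 1) := fun s => by
    refine (pastSpan_le_iff (isClosed_pastSpan x _)).2 fun r hr => ?_
    rcases hr.lt_or_eq with h | rfl
    · exact mem_pastSpan x (by lia)
    · exact hstep r
  have hle' : ∀ k : ℕ, pastSpan x 0 ≤ pastSpan x (-k) := fun k => by
    induction k with
    | zero => simp
    | succ k ih => exact ih.trans ((hle _).trans (pastSpan_mono x (by push_cast; lia)))
  refine h0 ?_
  have : x 0 ∈ ⨅ n : ℤ, pastSpan x n := by
    rw [Submodule.mem_iInf]
    intro n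
    refine pastSpan_mono x ?_ (hle' n.natAbs (mem_pastSpan x le_rfl))
    lia
  rwa [hp, Submodule.mem_bot] at this

/-- The innovations up to time `n` are total in the past of `n`. -/
theorem IsPurelyNondeterministic.eq_zero_of_inner_innovation {x : ℤ → E}
    (hp : IsPurelyNondeterministic x) {n : ℤ} {v : E} (hv : v ∈ pastSpan x n)
    (h : ∀ s ≤ n, inner ℝ v (innovation x s) = 0) : v = 0 := by
  -- Past `s` exceeds past `s - 1` only by the direction of the innovation at `s`. Orthogonality to
  -- it pushes `v` one step down, and iterating puts `v` in every past.
  have hstep : ∀ s ≤ n, v ∈ pastSpan x s → v ∈ pastSpan x (s - 1) := by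
    intro s hs hvs
    set p := (pastSpan x (s - 1)).starProjection v with hpdef
    have hpm : p ∈ pastSpan x (s - 1) := Submodule.starProjection_apply_mem _ _
    have hpast : ∀ z ∈ pastSpan x (s - 1), inner ℝ (v - p) z = 0 := fun z hz =>
      Submodule.starProjection_inner_eq_zero _ _ hz
    have hε : inner ℝ (v - p) (innovation x s) = 0 := by
      rw [inner_sub_left, h s hs, real_inner_comm, inner_innovation_of_mem x s hpm, sub_zero]
    have hall : ∀ r ≤ s, inner ℝ (v - p) (x r) = 0 := by
      intro r hr
      rcases hr.lt_or_eq with hr | rfl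
      · exact hpast _ (mem_pastSpan x (by lia))
      · have : x r = innovation x r + (pastSpan x (r - 1)).starProjection (x r) := by
          simp [innovation]
        rw [this, inner_add_right, hε, zero_add]
        exact hpast _ (Submodule.starProjection_apply_mem _ _)
    have hmem : v - p ∈ pastSpan x s := Submodule.sub_mem _ hvs (pastSpan_mono x (by lia) hpm)
    have := inner_eq_zero_of_mem_pastSpan hall hmem
    rw [inner_self_eq_zero, sub_eq_zero] at this
    rwa [this]
  have hall : ∀ k : ℕ, v ∈ pastSpan x (n - k) := by
    intro k
    induction k with
    | zero => simpa using hv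
    | succ k ih =>
      have := hstep (n - k) (by lia) ih
      rwa [show n - ((k + 1 : ℕ) : ℤ) = n - k - 1 by push_cast; ring]
  have : v ∈ ⨅ n : ℤ, pastSpan x n := by
    rw [Submodule.mem_iInf]
    intro m
    exact pastSpan_mono x (by lia) (hall (n - m).natAbs)
  rwa [hp, Submodule.mem_bot] at this

theorem IsStationarySeq.inner_innovation_sub {x : ℤ → E} (hx : IsStationarySeq x) (t : ℤ) (j : ℕ) :
    inner ℝ (x t) (innovation x (t - j)) = maCoeff x j * ‖innovation x 0‖ ^ 2 := by
  have h1 := hx.inner_innovation j (t - j)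
  have h2 := hx.inner_innovation j (-(j : ℤ))
  rw [add_sub_cancel] at h1
  rw [add_neg_cancel] at h2
  rw [maCoeff, hx.norm_innovation, h1, h2]
  by_cases h : ‖innovation x 0‖ = 0
  · rw [norm_eq_zero] at h
    simp [h]
  · field_simp

theorem IsStationarySeq.maCoeff_zero {x : ℤ → E} (hx : IsStationarySeq x)
    (hp : IsPurelyNondeterministic x) (h0 : x 0 ≠ 0) : maCoeff x 0 = 1 := by
  have := hx.innovation_ne_zero hp h0 0
  simp only [maCoeff, Nat.cast_zero, neg_zero, inner_self_innovation]
  field_simp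

theorem sum_antidiagonal_assoc {M : Type*} [AddCommMonoid M] (f : ℕ → ℕ → ℕ → M) (m : ℕ) :
    ∑ p ∈ antidiagonal m, ∑ q ∈ antidiagonal p.2, f p.1 q.1 q.2 =
      ∑ p ∈ antidiagonal m, ∑ q ∈ antidiagonal p.1, f q.1 q.2 p.2 := by
  rw [Finset.sum_sigma', Finset.sum_sigma']
  refine Finset.sum_nbij' (fun a => ⟨(a.1.1 + a.2.1, a.2.2), (a.1.1, a.2.1)⟩)
    (fun a => ⟨(a.2.1, a.2.2 + a.1.2), (a.2.2, a.1.2)⟩) ?_ ?_ ?_ ?_ ?_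
  all_goals
    rintro ⟨⟨a, b⟩, ⟨c, d⟩⟩ h
    simp only [Finset.mem_sigma, mem_antidiagonal] at h
    obtain ⟨rfl, rfl⟩ := h
    simp [add_assoc]

theorem sum_maCoeff_mul_arCoeff {x : ℤ → E} (h : maCoeff x 0 ≠ 0) (n : ℕ) :
    ∑ p ∈ antidiagonal n, maCoeff x p.1 * arCoeff x p.2 = if n = 0 then -1 else 0 := by
  have h1 : PowerSeries.mk (maCoeff x) * (PowerSeries.mk (maCoeff x))⁻¹ = 1 :=
    PowerSeries.mul_inv_cancel _ (by simpa using h)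
  have h2 := congrArg (PowerSeries.coeff n) h1
  rw [PowerSeries.coeff_mul, PowerSeries.coeff_one] at h2
  simp only [PowerSeries.coeff_mk] at h2
  simp only [arCoeff, mul_neg, Finset.sum_neg_distrib, h2]
  split_ifs <;> simp

theorem IsStationarySeq.summable_smul {ι : Type*} {x : ℤ → E} (hx : IsStationarySeq x) {c : ι → ℝ}
    (hc : Summable fun i => |c i|) (t : ι → ℤ) : Summable fun i => c i • x (t i) := by
  refine Summable.of_norm ((hc.mul_right ‖x 0‖).congr fun i => ?_)
  rw [norm_smul, hx.norm_eq (t i), Real.norm_eq_abs]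

/-- Both sides lie in the past of `t`, so it is enough to pair them with the innovation at each `t -
n`. The series gives the convolution of `ψ` and `φ` at `n` times the innovation variance, that is,
`-1` or `0` times it. -/
theorem IsStationarySeq.hasSum_arCoeff {x : ℤ → E} (hx : IsStationarySeq x)
    (hp : IsPurelyNondeterministic x) (h0 : x 0 ≠ 0) (hφ : Summable fun j => |arCoeff x j|)
    (t : ℤ) : HasSum (fun j : ℕ => arCoeff x j • x (t - j)) (-innovation x t) := by
  have hs := hx.summable_smul hφ fun j : ℕ => t - j
  set w := ∑' j : ℕ, arCoeff x j • x (t - j) with hw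
  have hmem : w ∈ pastSpan x t := by
    refine (isClosed_pastSpan x t).mem_of_tendsto hs.hasSum (Eventually.of_forall fun s => ?_)
    exact Submodule.sum_mem _ fun i _ => Submodule.smul_mem _ _ (mem_pastSpan x (by lia))
  suffices innovation x t + w = 0 by
    rw [neg_eq_of_add_eq_zero_right this]
    exact hs.hasSum
  refine hp.eq_zero_of_inner_innovation (Submodule.add_mem _ (innovation_mem x t) hmem)
    fun s hs' => ?_
  obtain ⟨n, rfl⟩ : ∃ n : ℕ, s = t - n := ⟨(t - s).toNat, by lia⟩
  have h1 : HasSum (fun j : ℕ => inner ℝ (arCoeff x j • x (t - j)) (innovation x (t - n)))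
      (inner ℝ w (innovation x (t - n))) := by
    have := hs.hasSum.mapL (innerSL ℝ (innovation x (t - n)))
    simpa only [innerSL_apply_apply, real_inner_comm] using this
  have h2 : ∀ j ∉ Finset.range (n + 1),
      inner ℝ (arCoeff x j • x (t - j)) (innovation x (t - n)) = 0 := fun j hj => by
    rw [Finset.mem_range] at hj
    rw [real_inner_smul_left, inner_innovation_of_lt x (by lia), mul_zero]
  have h3 := h1.unique (hasSum_sum_of_ne_finset_zero h2)
  have h4 : ∑ j ∈ Finset.range (n + 1),
      inner ℝ (arCoeff x j • x (t - j)) (innovation x (t - n)) =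
      (∑ p ∈ antidiagonal n, maCoeff x p.1 * arCoeff x p.2) * ‖innovation x 0‖ ^ 2 := by
    rw [← Finset.Nat.sum_antidiagonal_swap, Finset.Nat.sum_antidiagonal_eq_sum_range_succ_mk,
      Finset.sum_mul]
    refine Finset.sum_congr rfl fun j hj => ?_
    rw [Finset.mem_range] at hj
    have := hx.inner_innovation_sub (t - j) (n - j)
    rw [show t - j - ((n - j : ℕ) : ℤ) = t - n by lia] at this
    rw [real_inner_smul_left, this, Prod.swap_prod_mk]
    ring
  rw [inner_add_left, h3, h4, sum_maCoeff_mul_arCoeff (by rw [hx.maCoeff_zero hp h0]; simp)]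
  split_ifs with hn
  · subst hn
    simp [hx.norm_innovation t]
  · rw [innovation_inner_innovation x (by lia)]
    simp

/-- The coefficient of `x (n - k)` in the projection of `x (n + m + 1)` on the past of `n`. -/
noncomputable def predictorCoeff (x : ℤ → E) (m k : ℕ) : ℝ :=
  ∑ p ∈ antidiagonal m, maCoeff x p.1 * arCoeff x (p.2 + k + 1)

theorem summable_predictorCoeff {x : ℤ → E} (hφ : Summable fun j => |arCoeff x j|) (m : ℕ) :
    Summable fun k => |predictorCoeff x m k| := by
  refine Summable.abs (summable_sum fun p _ => Summable.mul_left _ ?_)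
  exact hφ.of_abs.comp_injective fun a b h => by simpa using h

/-- Weight the autoregressive equations at the times `n + j + 1` by `ψ_i`, `i + j = m`, and add. All
future values except the last cancel, leaving it minus a combination of future innovations; these
are orthogonal to the past of `n`. -/
theorem IsStationarySeq.hasSum_predictorCoeff {x : ℤ → E} (hx : IsStationarySeq x)
    (hp : IsPurelyNondeterministic x) (h0 : x 0 ≠ 0) (hφ : Summable fun j => |arCoeff x j|)
    (n : ℤ) (m : ℕ) : HasSum (fun k : ℕ => predictorCoeff x m k • x (n - k))
      ((pastSpan x n).starProjection (x (n + (m + 1 : ℕ)))) := by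
  set w := x (n + (m + 1 : ℕ)) -
    ∑ p ∈ antidiagonal m, maCoeff x p.1 • innovation x (n + (p.2 + 1 : ℕ)) with hwdef
  have hw : HasSum (fun k : ℕ => predictorCoeff x m k • x (n - k)) w := by
    have h1 : ∀ p ∈ antidiagonal m, HasSum
        (fun k : ℕ => (maCoeff x p.1 * arCoeff x (p.2 + k + 1)) • x (n - k))
        (-(maCoeff x p.1 • innovation x (n + (p.2 + 1 : ℕ))) -
          ∑ i ∈ Finset.range (p.2 + 1), (maCoeff x p.1 * arCoeff x i) •
            x (n + (p.2 + 1 : ℕ) - i)) := by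
      intro p _
      have h2 := (hx.hasSum_arCoeff hp h0 hφ (n + (p.2 + 1 : ℕ))).const_smul (maCoeff x p.1)
      rw [← hasSum_nat_add_iff' (p.2 + 1), smul_neg] at h2
      simp only [smul_smul] at h2
      refine HasSum.congr_fun h2 fun k => ?_
      rw [show k + (p.2 + 1) = p.2 + k + 1 by ring]
      congr 2
      push_cast
      ring
    have h2 := hasSum_sum h1
    simp only [← Finset.sum_smul] at h2
    convert h2 using 1
    · rfl
    rw [Finset.sum_sub_distrib, Finset.sum_neg_distrib, hwdef, sub_eq_neg_add, sub_eq_add_neg]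
    congr 1
    have h3 : ∀ p ∈ antidiagonal m, ∑ i ∈ Finset.range (p.2 + 1),
        (maCoeff x p.1 * arCoeff x i) • x (n + (p.2 + 1 : ℕ) - i) =
        ∑ q ∈ antidiagonal p.2, (maCoeff x p.1 * arCoeff x q.1) • x (n + (q.2 + 1 : ℕ)) := by
      intro p _
      rw [Finset.Nat.sum_antidiagonal_eq_sum_range_succ_mk]
      refine Finset.sum_congr rfl fun i hi => ?_
      rw [Finset.mem_range] at hi
      congr 2
      lia
    -- Regrouped by `c`, the coefficient of `x (n + c + 1)` is the convolution of `ψ` and `φ` at `m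
    -- - c`, nonzero only for `c = m`.
    rw [Finset.sum_congr rfl h3, sum_antidiagonal_assoc
      fun a b c => (maCoeff x a * arCoeff x b) • x (n + (c + 1 : ℕ))]
    simp only [← Finset.sum_smul]
    rw [Finset.sum_eq_single (0, m)]
    · rw [sum_maCoeff_mul_arCoeff (by rw [hx.maCoeff_zero hp h0]; simp)]
      simp
    · rintro ⟨a, b⟩ hab hne
      rw [sum_maCoeff_mul_arCoeff (by rw [hx.maCoeff_zero hp h0]; simp), if_neg, zero_smul]
      rintro rfl
      simp only [mem_antidiagonal, zero_add] at hab
      exact hne (by rw [hab])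
    · intro h
      exact absurd (mem_antidiagonal.2 (zero_add m)) h
  have hmem : w ∈ pastSpan x n := by
    refine (isClosed_pastSpan x n).mem_of_tendsto hw (Eventually.of_forall fun s => ?_)
    exact Submodule.sum_mem _ fun i _ => Submodule.smul_mem _ _ (mem_pastSpan x (by lia))
  rw [Submodule.eq_starProjection_of_mem_of_inner_eq_zero hmem fun z hz => ?_]
  · exact hw
  · rw [hwdef, sub_sub_cancel, sum_inner]
    refine Finset.sum_eq_zero fun p _ => ?_
    rw [real_inner_smul_left,
      inner_innovation_of_mem x _ (pastSpan_mono x (by push_cast; lia) hz), mul_zero]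

/-- Pairing with the innovation at `n - k` kills all older terms, while the newer ones vanish by
induction. Only ordered convergence of partial sums is used, as the definition of the infinite
minimizer requires. -/
theorem IsStationarySeq.eq_zero_of_tendsto_zero {x : ℤ → E} (hx : IsStationarySeq x)
    (hp : IsPurelyNondeterministic x) (h0 : x 0 ≠ 0) {n : ℤ} {c : ℕ → ℝ}
    (h : Tendsto (fun N : ℕ => ∑ k ∈ Finset.range N, c k • x (n - k)) atTop (𝓝 0)) (k : ℕ) :
    c k = 0 := by
  induction k using Nat.strong_induction_on with
  | _ k ih =>
    have h1 : Tendsto (fun N : ℕ => inner ℝ (innovation x (n - k))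
        (∑ k ∈ Finset.range N, c k • x (n - k))) atTop (𝓝 (inner ℝ (innovation x (n - k)) 0)) :=
      tendsto_const_nhds.inner h
    rw [inner_zero_right] at h1
    have h2 : Tendsto (fun N : ℕ => inner ℝ (innovation x (n - k))
        (∑ k ∈ Finset.range N, c k • x (n - k))) atTop (𝓝 (c k * ‖innovation x (n - k)‖ ^ 2)) := by
      refine tendsto_const_nhds.congr' ?_
      filter_upwards [eventually_gt_atTop k] with N hN
      rw [inner_sum, Finset.sum_eq_single k]
      · rw [real_inner_smul_right, real_inner_comm, inner_self_innovation]
      · intro j _ hj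
        rcases lt_or_gt_of_ne hj with hj | hj
        · rw [ih j hj, zero_smul, inner_zero_right]
        · rw [real_inner_smul_right, real_inner_comm, inner_innovation_of_lt x (by lia), mul_zero]
      · intro hk
        exact absurd (Finset.mem_range.2 hN) hk
    have h3 := tendsto_nhds_unique h1 h2
    have h4 := hx.innovation_ne_zero hp h0 (n - k)
    simpa [h4] using h3.symm

end Wold

/-! ### Minimizers as coordinates of projections -/

section Minimizers

variable {E : Type*} [NormedAddCommGroup E] [InnerProductSpace ℝ E]

theorem norm_sub_sq_eq_add_of_mem (K : Submodule ℝ E) [K.HasOrthogonalProjection] (y : E) {v : E}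
    (hv : v ∈ K) :
    ‖y - v‖ ^ 2 = ‖y - K.starProjection y‖ ^ 2 + ‖K.starProjection y - v‖ ^ 2 := by
  have h : inner ℝ (y - K.starProjection y) (K.starProjection y - v) = 0 :=
    Submodule.starProjection_inner_eq_zero _ _
      (Submodule.sub_mem _ (Submodule.starProjection_apply_mem _ _) hv)
  have h1 := norm_add_sq_real (y - K.starProjection y) (K.starProjection y - v)
  rw [sub_add_sub_cancel, h] at h1
  linarith

theorem norm_sub_starProjection_sq_le (K : Submodule ℝ E) [K.HasOrthogonalProjection] (y : E)
    {v : E} (hv : v ∈ K) : ‖y - K.starProjection y‖ ^ 2 ≤ ‖y - v‖ ^ 2 := by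
  rw [norm_sub_sq_eq_add_of_mem K y hv]
  exact le_add_of_nonneg_right (sq_nonneg _)

theorem eq_starProjection_of_norm_sub_sq_le (K : Submodule ℝ E) [K.HasOrthogonalProjection]
    {y v : E} (hv : v ∈ K) (h : ‖y - v‖ ^ 2 ≤ ‖y - K.starProjection y‖ ^ 2) :
    v = K.starProjection y := by
  rw [norm_sub_sq_eq_add_of_mem K y hv] at h
  have h1 : ‖K.starProjection y - v‖ ^ 2 = 0 := le_antisymm (by linarith) (sq_nonneg _)
  exact (sub_eq_zero.1 (norm_eq_zero.1 (pow_eq_zero_iff two_ne_zero |>.1 h1))).symm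

theorem sum_Icc_smul_eq_sum_range (x : ℤ → E) (n : ℤ) (a : ℕ → ℝ) (N : ℕ) :
    ∑ k ∈ Finset.Icc 1 N, a k • x (n + 1 - k) = ∑ k ∈ Finset.range N, a (k + 1) • x (n - k) := by
  have h : Finset.Icc 1 N = Finset.Ico (0 + 1) (N + 1) := by
    ext
    simp
  rw [h, ← Finset.sum_Ico_add' (fun k : ℕ => a k • x (n + 1 - k)), ← Finset.range_eq_Ico]
  refine Finset.sum_congr rfl fun k _ => ?_
  congr 2
  push_cast
  ring

/-- The reflection `t ↦ n + 1 - t` preserves the window `1, …, n` and exchanges `n + m` with `1 -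
m`. -/
theorem IsStationarySeq.norm_sub_sum_reflect {x : ℤ → E} (hx : IsStationarySeq x) (n m : ℕ)
    (c : ℕ → ℝ) :
    ‖x (1 - m) - ∑ k ∈ Finset.Icc 1 n, c (n + 1 - k) • x (n + 1 - k)‖ ^ 2 =
      ‖x (n + m) - ∑ k ∈ Finset.Icc 1 n, c k • x (n + 1 - k)‖ ^ 2 := by
  have h1 : ∑ k ∈ Finset.Icc 1 n, c (n + 1 - k) • x (n + 1 - k) =
      ∑ k ∈ Finset.Icc 1 n, c k • x k := by
    refine Finset.sum_nbij' (fun k => n + 1 - k) (fun k => n + 1 - k) ?_ ?_ ?_ ?_ ?_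
    all_goals
      intro k hk
      simp only [Finset.mem_Icc] at hk ⊢
    · lia
    · lia
    · lia
    · lia
    · congr 2
      lia
  rw [h1, norm_sub_sq_real, norm_sub_sq_real, hx.norm_eq, hx.norm_eq (n + m),
    norm_sum_smul_eq_of_gram (z := fun k : ℕ => x (n + 1 - k)) _
      fun i _ j _ => (hx.inner_reflect i j (n + 1)).symm]
  simp only [inner_sum, real_inner_smul_right]
  congr 3
  refine Finset.sum_congr rfl fun k _ => ?_
  rw [← hx.inner_reflect (1 - m) k (n + 1)]
  congr 3
  ring

theorem IsStationarySeq.isFinMinimizer_reflect {x : ℤ → E} (hx : IsStationarySeq x) {n m : ℕ}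
    {a : ℕ → ℝ} (h : IsFinMinimizer x n (x (n + m)) a) :
    IsFinMinimizer x n (x (1 - m)) fun k => a (n + 1 - k) := by
  intro b
  have h1 : ∑ k ∈ Finset.Icc 1 n, b k • x (n + 1 - k) =
      ∑ k ∈ Finset.Icc 1 n, (fun j => b (n + 1 - j)) (n + 1 - k) • x (n + 1 - k) := by
    refine Finset.sum_congr rfl fun k hk => ?_
    rw [Finset.mem_Icc] at hk
    simp only
    rw [Nat.sub_sub_self (by lia)]
  rw [h1]
  beta_reduce
  rw [hx.norm_sub_sum_reflect n m a, hx.norm_sub_sum_reflect n m fun j => b (n + 1 - j)]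
  exact h _

theorem finCoeff_eq_of_isFinMinimizer_iff {x : ℤ → E} {n : ℕ} {f : E →L[ℝ] (Fin n → ℝ)}
    (hf : ∀ y a, IsFinMinimizer x n y a ↔ ∀ i : Fin n, a (i + 1) = f y i) (y : E) (i : Fin n) :
    finCoeff x n y (i + 1) = f y i := by
  have h : ∃ a : ℕ → ℝ, IsFinMinimizer x n y a :=
    ⟨fun k => if h : k - 1 < n then f y ⟨k - 1, h⟩ else 0, (hf y _).2 fun i => by simp⟩
  exact (hf y _).1 (Classical.epsilon_spec h) i

variable [CompleteSpace E]

/-- Every admissible limit lies in the past, and `c` attains the projection. A minimizing limit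
therefore equals the projection, and uniqueness of expansions gives the coefficients. -/
theorem IsStationarySeq.isInfMinimizer_iff {x : ℤ → E} (hx : IsStationarySeq x)
    (hp : IsPurelyNondeterministic x) (h0 : x 0 ≠ 0) {n : ℤ} {y : E} {c : ℕ → ℝ}
    (hc : HasSum (fun k : ℕ => c k • x (n - k)) ((pastSpan x n).starProjection y)) (a : ℕ → ℝ) :
    IsInfMinimizer x n y a ↔ ∀ k, a (k + 1) = c k := by
  have hlim : Tendsto (fun N : ℕ => ∑ k ∈ Finset.Icc 1 N, c (k - 1) • x (n + 1 - k)) atTop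
      (𝓝 ((pastSpan x n).starProjection y)) := by
    simp only [sum_Icc_smul_eq_sum_range x n fun k => c (k - 1), Nat.add_sub_cancel]
    exact hc.tendsto_sum_nat
  have hmem : ∀ (b : ℕ → ℝ) (v : E),
      Tendsto (fun N : ℕ => ∑ k ∈ Finset.Icc 1 N, b k • x (n + 1 - k)) atTop (𝓝 v) →
        v ∈ pastSpan x n := fun b v hv =>
    (isClosed_pastSpan x n).mem_of_tendsto hv (Eventually.of_forall fun N =>
      Submodule.sum_mem _ fun k hk => Submodule.smul_mem _ _ (mem_pastSpan x (by
        rw [Finset.mem_Icc] at hk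
        lia)))
  constructor
  · rintro ⟨w, hw, hmin⟩ k
    have hwP := eq_starProjection_of_norm_sub_sq_le _ (hmem a w hw) (hmin _ _ hlim)
    subst hwP
    rw [← sub_eq_zero]
    refine hx.eq_zero_of_tendsto_zero hp h0 (n := n) (c := fun k => a (k + 1) - c k) ?_ k
    have h1 := hw.sub hlim
    simp only [sub_self, sum_Icc_smul_eq_sum_range x n fun k => c (k - 1), Nat.add_sub_cancel,
      sum_Icc_smul_eq_sum_range x n a, ← Finset.sum_sub_distrib, ← sub_smul] at h1
    exact h1
  · intro h
    refine ⟨_, ?_, fun b v hv => norm_sub_starProjection_sq_le _ y (hmem b v hv)⟩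
    simp only [sum_Icc_smul_eq_sum_range x n a, h]
    exact hc.tendsto_sum_nat

/-- A single `c` serving all `n` is what makes the choice in `infCoeff` meaningful; its value can
then be read off at `n = 1`. -/
theorem IsStationarySeq.infCoeff_eq {x : ℤ → E} (hx : IsStationarySeq x)
    (hp : IsPurelyNondeterministic x) (h0 : x 0 ≠ 0) {Y : ℕ → E} {c : ℕ → ℝ}
    (hc : ∀ n : ℕ, 1 ≤ n → HasSum (fun k : ℕ => c k • x (n - k))
      ((pastSpan x n).starProjection (Y n))) (k : ℕ) : infCoeff x Y (k + 1) = c k := by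
  have h : ∃ a : ℕ → ℝ, ∀ n : ℕ, 1 ≤ n → IsInfMinimizer x n (Y n) a :=
    ⟨fun k => c (k - 1), fun n hn => (hx.isInfMinimizer_iff hp h0 (hc n hn) _).2 fun k => rfl⟩
  exact (hx.isInfMinimizer_iff hp h0 (hc 1 le_rfl) _).1 (Classical.epsilon_spec h 1 le_rfl) k

theorem IsStationarySeq.isInfMinimizer_iff_infCoeff {x : ℤ → E} (hx : IsStationarySeq x)
    (hp : IsPurelyNondeterministic x) (h0 : x 0 ≠ 0) {Y : ℕ → E} {c : ℕ → ℝ}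
    (hc : ∀ n : ℕ, 1 ≤ n → HasSum (fun k : ℕ => c k • x (n - k))
      ((pastSpan x n).starProjection (Y n))) {n : ℕ} (hn : 1 ≤ n) (a : ℕ → ℝ) :
    IsInfMinimizer x n (Y n) a ↔ ∀ k, 1 ≤ k → a k = infCoeff x Y k := by
  rw [hx.isInfMinimizer_iff hp h0 (hc n hn)]
  constructor
  · intro h k hk
    obtain ⟨k, rfl⟩ := Nat.exists_eq_add_of_le' hk
    rw [h, hx.infCoeff_eq hp h0 hc]
  · intro h k
    rw [h _ (Nat.le_add_left 1 k), hx.infCoeff_eq hp h0 hc]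

theorem IsStationarySeq.linearIndependent {x : ℤ → E} (hx : IsStationarySeq x)
    (hp : IsPurelyNondeterministic x) (h0 : x 0 ≠ 0) (n : ℕ) :
    LinearIndependent ℝ fun i : Fin n => x (n - (i : ℕ)) := by
  rw [Fintype.linearIndependent_iff]
  intro g hg i
  set c : ℕ → ℝ := fun k => if h : k < n then g ⟨k, h⟩ else 0 with hc
  have h1 : Tendsto (fun N : ℕ => ∑ k ∈ Finset.range N, c k • x (n - k)) atTop (𝓝 0) := by
    refine tendsto_const_nhds.congr' ?_
    filter_upwards [eventually_ge_atTop n] with N hN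
    rw [← Finset.sum_subset (Finset.range_mono hN) fun k _ hk => ?_,
      Finset.sum_range fun k => c k • x (n - k), ← hg]
    · exact Finset.sum_congr rfl fun j _ => by simp [hc]
    · rw [Finset.mem_range] at hk
      simp [hc, hk]
  have := hx.eq_zero_of_tendsto_zero hp h0 h1 i
  simpa [hc] using this

/-- The finite predictor coefficients depend linearly and continuously on the target. -/
theorem IsStationarySeq.exists_isFinMinimizer_iff {x : ℤ → E} (hx : IsStationarySeq x)
    (hp : IsPurelyNondeterministic x) (h0 : x 0 ≠ 0) (n : ℕ) :
    ∃ f : E →L[ℝ] (Fin n → ℝ), ∀ y a,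
      IsFinMinimizer x n y a ↔ ∀ i : Fin n, a (i + 1) = f y i := by
  have hli := hx.linearIndependent hp h0 n
  set v : Fin n → E := fun i => x (n - (i : ℕ)) with hv
  set K := Submodule.span ℝ (Set.range v) with hK
  have : FiniteDimensional ℝ K := FiniteDimensional.span_of_finite ℝ (Set.finite_range v)
  let b : Module.Basis (Fin n) ℝ K := Module.Basis.span hli
  let f : E →L[ℝ] (Fin n → ℝ) := (b.equivFun.toLinearMap.toContinuousLinearMap).comp
    K.orthogonalProjectionOnto
  have hsum : ∀ a : ℕ → ℝ, ∑ k ∈ Finset.Icc 1 n, a k • x (n + 1 - k) =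
      ∑ i : Fin n, a (i + 1) • v i := fun a => by
    rw [sum_Icc_smul_eq_sum_range x n a, Finset.sum_range fun k => a (k + 1) • x (n - k)]
  have hmem : ∀ a : Fin n → ℝ, ∑ i, a i • v i ∈ K := fun a =>
    Submodule.sum_mem _ fun i _ => Submodule.smul_mem _ _ (Submodule.subset_span ⟨i, rfl⟩)
  have hf : ∀ y, ∑ i, f y i • v i = K.starProjection y := fun y => by
    have h1 := congrArg (Subtype.val) (b.sum_equivFun (K.orthogonalProjectionOnto y))
    rw [Submodule.coe_sum] at h1
    have h2 : ∀ i, (b i : E) = v i := fun i => congrArg Subtype.val (Module.Basis.span_apply hli i)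
    simp only [Submodule.coe_smul, h2] at h1
    exact h1
  refine ⟨f, fun y a => ⟨fun h => ?_, fun h c => ?_⟩⟩
  · have h1 := h fun k => if h : k - 1 < n then f y ⟨k - 1, h⟩ else 0
    rw [hsum, hsum] at h1
    simp only [Nat.add_sub_cancel, Fin.is_lt, dite_true, Fin.eta, hf] at h1
    have h2 := eq_starProjection_of_norm_sub_sq_le K (hmem _) h1
    rw [← hf, ← sub_eq_zero, ← Finset.sum_sub_distrib] at h2
    simp only [← sub_smul] at h2
    exact fun i => sub_eq_zero.1 (Fintype.linearIndependent_iff.1 hli _ h2 i)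
  · rw [hsum, hsum]
    simp only [h, hf]
    exact norm_sub_starProjection_sq_le K y (hmem _)

theorem IsStationarySeq.isFinMinimizer_iff_finCoeff {x : ℤ → E} (hx : IsStationarySeq x)
    (hp : IsPurelyNondeterministic x) (h0 : x 0 ≠ 0) (n : ℕ) (y : E) (a : ℕ → ℝ) :
    IsFinMinimizer x n y a ↔ ∀ k ∈ Finset.Icc 1 n, a k = finCoeff x n y k := by
  obtain ⟨f, hf⟩ := hx.exists_isFinMinimizer_iff hp h0 n
  rw [hf]
  constructor
  · intro h k hk
    rw [Finset.mem_Icc] at hk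
    obtain ⟨k, rfl⟩ := Nat.exists_eq_add_of_le' hk.1
    exact (h ⟨k, hk.2⟩).trans (finCoeff_eq_of_isFinMinimizer_iff hf y ⟨k, hk.2⟩).symm
  · intro h i
    rw [h _ (Finset.mem_Icc.2 ⟨by lia, i.2⟩), finCoeff_eq_of_isFinMinimizer_iff hf]

/-- Time reversal: the coefficients for `x (1 - m)` are those for `x (n + m)` in reverse order. -/
theorem IsStationarySeq.finCoeff_reflect {x : ℤ → E} (hx : IsStationarySeq x)
    (hp : IsPurelyNondeterministic x) (h0 : x 0 ≠ 0) (n m : ℕ) {k : ℕ}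
    (hk : k ∈ Finset.Icc 1 n) :
    finCoeff x n (x (1 - m)) k = finStepCoeff x n m (n + 1 - k) :=
  ((hx.isFinMinimizer_iff_finCoeff hp h0 n _ _).1 (hx.isFinMinimizer_reflect
    ((hx.isFinMinimizer_iff_finCoeff hp h0 n _ (finStepCoeff x n m)).2 fun _ _ => rfl)) k hk).symm

theorem IsStationarySeq.finCoeff_self {x : ℤ → E} (hx : IsStationarySeq x)
    (hp : IsPurelyNondeterministic x) (h0 : x 0 ≠ 0) {n j : ℕ} (hj : j < n) {k : ℕ}
    (hk : k ∈ Finset.Icc 1 n) :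
    finCoeff x n (x (n - j)) k = if k = j + 1 then 1 else 0 := by
  have h : IsFinMinimizer x n (x (n - j)) fun k => if k = j + 1 then 1 else 0 := by
    intro b
    have h1 : ∑ k ∈ Finset.Icc 1 n, (if k = j + 1 then (1 : ℝ) else 0) • x (n + 1 - k) =
        x (n - j) := by
      simp only [ite_smul, one_smul, zero_smul, Finset.sum_ite_eq', Finset.mem_Icc]
      rw [if_pos (by lia)]
      congr 1
      push_cast
      ring
    rw [h1, sub_self, norm_zero, zero_pow two_ne_zero]
    exact sq_nonneg _
  exact ((hx.isFinMinimizer_iff_finCoeff hp h0 n _ _).1 h k hk).symm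

end Minimizers

/-! ### The target projected term by term -/

section Formulas

variable {E : Type*} [NormedAddCommGroup E] [InnerProductSpace ℝ E] [CompleteSpace E]

theorem IsStationarySeq.stepCoeff_eq {x : ℤ → E} (hx : IsStationarySeq x)
    (hp : IsPurelyNondeterministic x) (h0 : x 0 ≠ 0) (hφ : Summable fun j => |arCoeff x j|)
    (m k : ℕ) : stepCoeff x (m + 1) (k + 1) = predictorCoeff x m k :=
  hx.infCoeff_eq hp h0 (fun n _ => hx.hasSum_predictorCoeff hp h0 hφ n m) k

theorem IsStationarySeq.hasSum_starProjection_target {x : ℤ → E} (hx : IsStationarySeq x)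
    (hp : IsPurelyNondeterministic x) (h0 : x 0 ≠ 0) (hφ : Summable fun j => |arCoeff x j|)
    {h : ℤ → ℝ}
    (hC : Summable fun p : ℕ × ℕ => |h (-((p.1 : ℤ) + 1)) * predictorCoeff x p.1 p.2|)
    {n : ℤ} (hB : Summable fun k : ℤ => h k • x (n - k)) :
    HasSum (fun k : ℕ => ((∑' m : ℕ, h (-((m : ℤ) + 1)) * predictorCoeff x m k) + h k) • x (n - k))
      ((pastSpan x n).starProjection (∑' k : ℤ, h k • x (n - k))) := by
  have hP := hB.hasSum.mapL (pastSpan x n).starProjection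
  obtain ⟨A, hA⟩ : Summable fun k : ℕ => h k • x (n - k) := hB.comp_injective Nat.cast_injective
  have hA' : HasSum (fun k : ℕ => (pastSpan x n).starProjection (h k • x (n - k))) A := by
    refine HasSum.congr_fun hA fun k => ?_
    exact Submodule.starProjection_eq_self_iff.2
      (Submodule.smul_mem _ _ (mem_pastSpan x (by lia)))
  obtain ⟨S, hS⟩ := hx.summable_smul hC fun p => n - (p.2 : ℤ)
  -- The double series with sum `S` is read twice: over `k` first it gives the projected future
  -- terms, over `m` first the coefficient of each past variable.
  have hS' : HasSum (fun m : ℕ => (pastSpan x n).starProjection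
      (h (-((m : ℤ) + 1)) • x (n - -((m : ℤ) + 1)))) S := by
    refine hS.prod_fiberwise fun m => ?_
    have := (hx.hasSum_predictorCoeff hp h0 hφ n m).const_smul (h (-((m : ℤ) + 1)))
    simp only [smul_smul] at this
    rw [map_smul, sub_neg_eq_add]
    exact this
  have hS'' : HasSum (fun k : ℕ =>
      (∑' m : ℕ, h (-((m : ℤ) + 1)) * predictorCoeff x m k) • x (n - k)) S := by
    refine HasSum.prod_fiberwise ((Equiv.prodComm ℕ ℕ).hasSum_iff.2 hS) fun k => ?_
    have hk := hC.of_abs.comp_injective (Prod.mk_left_injective k)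
    simp only [Function.comp_def] at hk
    exact hk.hasSum.smul_const (x (n - k))
  have htotal := HasSum.of_nat_of_neg_add_one
    (f := fun k : ℤ => (pastSpan x n).starProjection (h k • x (n - k))) hA' hS'
  rw [← htotal.unique hP, add_comm]
  simp only [add_smul]
  exact hS''.add hA

theorem IsStationarySeq.hHat_eq {x : ℤ → E} (hx : IsStationarySeq x)
    (hp : IsPurelyNondeterministic x) (h0 : x 0 ≠ 0) (hφ : Summable fun j => |arCoeff x j|)
    {h : ℤ → ℝ}
    (hC : Summable fun p : ℕ × ℕ => |h (-((p.1 : ℤ) + 1)) * predictorCoeff x p.1 p.2|)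
    (hB : ∀ n : ℕ, 1 ≤ n → Summable fun k : ℤ => h k • x (n - k)) (k : ℕ) :
    hHat x h (k + 1) = (∑' m : ℕ, h (-((m : ℤ) + 1)) * predictorCoeff x m k) + h k :=
  hx.infCoeff_eq hp h0 (fun n hn => hx.hasSum_starProjection_target hp h0 hφ hC (hB n hn)) k

theorem IsStationarySeq.hHat_formula {x : ℤ → E} (hx : IsStationarySeq x)
    (hp : IsPurelyNondeterministic x) (h0 : x 0 ≠ 0) (hφ : Summable fun j => |arCoeff x j|)
    {h : ℤ → ℝ}
    (hC : Summable fun p : ℕ × ℕ => |h (-((p.1 : ℤ) + 1)) * predictorCoeff x p.1 p.2|)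
    (hB : ∀ n : ℕ, 1 ≤ n → Summable fun k : ℤ => h k • x (n - k)) {k : ℕ} (hk : 1 ≤ k) :
    Summable (fun m : ℕ+ => |h (-(m : ℤ)) * stepCoeff x m k|) ∧
      hHat x h k = (∑' m : ℕ+, h (-(m : ℤ)) * stepCoeff x m k) + h ((k : ℤ) - 1) := by
  obtain ⟨k, rfl⟩ := Nat.exists_eq_add_of_le' hk
  constructor
  · refine (summable_pnat_iff_summable_succ
      (f := fun m : ℕ => |h (-(m : ℤ)) * stepCoeff x m (k + 1)|)).2 ?_
    simp only [hx.stepCoeff_eq hp h0 hφ, Nat.cast_succ]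
    have hk := hC.comp_injective (Prod.mk_left_injective k)
    simp only [Function.comp_def] at hk
    exact hk
  · rw [tsum_pnat_eq_tsum_succ (f := fun m : ℕ => h (-(m : ℤ)) * stepCoeff x m (k + 1))]
    simp only [hx.stepCoeff_eq hp h0 hφ, Nat.cast_succ, add_sub_cancel_right]
    exact hx.hHat_eq hp h0 hφ hC hB k

/-- Apply the coefficient functional to the target series and split the index into `j < 0`, `0 ≤ j <
n` and `j ≥ n`. Absolute convergence is automatic, since summability in `ℝ` is absolute. -/
theorem IsStationarySeq.hHatFin_formula {x : ℤ → E} (hx : IsStationarySeq x)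
    (hp : IsPurelyNondeterministic x) (h0 : x 0 ≠ 0) {h : ℤ → ℝ} {n : ℕ}
    (hB : Summable fun k : ℤ => h k • x (n - k)) {k : ℕ} (hk : k ∈ Finset.Icc 1 n) :
    Summable (fun m : ℕ+ => |h (-(m : ℤ)) * finStepCoeff x n m k|) ∧
      Summable (fun m : ℕ+ => |h ((n : ℤ) - 1 + (m : ℤ)) * finStepCoeff x n m (n + 1 - k)|) ∧
      hHatFin x h n k =
        (∑' m : ℕ+, h (-(m : ℤ)) * finStepCoeff x n m k) + h ((k : ℤ) - 1) +
          ∑' m : ℕ+, h ((n : ℤ) - 1 + (m : ℤ)) * finStepCoeff x n m (n + 1 - k) := by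
  obtain ⟨f, hf⟩ := hx.exists_isFinMinimizer_iff hp h0 n
  have hcoeff : ∀ y, finCoeff x n y k = f y ⟨k - 1, by rw [Finset.mem_Icc] at hk; lia⟩ := fun y => by
    rw [← finCoeff_eq_of_isFinMinimizer_iff hf]
    rw [Finset.mem_Icc] at hk
    simp only [Nat.sub_add_cancel hk.1]
  have hs : HasSum (fun j : ℤ => h j * finCoeff x n (x (n - j)) k) (hHatFin x h n k) := by
    have h1 := (hB.hasSum.mapL f).mapL
      (ContinuousLinearMap.proj (R := ℝ) (φ := fun _ : Fin n => ℝ)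
        ⟨k - 1, by rw [Finset.mem_Icc] at hk; lia⟩)
    simp only [map_smul, ContinuousLinearMap.proj_apply, ← hcoeff, smul_eq_mul] at h1
    exact h1
  have hneg : ∀ m : ℕ, h (-((m : ℤ) + 1)) * finCoeff x n (x (n - -((m : ℤ) + 1))) k =
      h (-((m + 1 : ℕ) : ℤ)) * finStepCoeff x n (m + 1) k := fun m => by
    rw [finStepCoeff, sub_neg_eq_add, Nat.cast_succ]
  have hpos : ∀ m : ℕ, h ((m + n : ℕ) : ℤ) * finCoeff x n (x (n - ((m + n : ℕ) : ℤ))) k =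
      h ((n : ℤ) - 1 + (m + 1 : ℕ)) * finStepCoeff x n (m + 1) (n + 1 - k) := fun m => by
    rw [← hx.finCoeff_reflect hp h0 n _ hk]
    congr 3
    · push_cast
      ring
    · push_cast
      ring
  have hmid : ∑ j ∈ Finset.range n, h (j : ℤ) * finCoeff x n (x (n - (j : ℤ))) k =
      h ((k : ℤ) - 1) := by
    rw [Finset.sum_congr rfl fun j hj => by
      rw [hx.finCoeff_self hp h0 (Finset.mem_range.1 hj) hk]]
    rw [Finset.mem_Icc] at hk
    rw [Finset.sum_eq_single (k - 1)]
    · rw [if_pos (by lia), mul_one, Nat.cast_sub hk.1, Nat.cast_one]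
    · intro j _ hj
      rw [if_neg (by lia), mul_zero]
    · intro hk'
      exact absurd (Finset.mem_range.2 (by lia)) hk'
  set g : ℤ → ℝ := fun j => h j * finCoeff x n (x (n - j)) k with hg
  have hs1 : Summable fun m : ℕ => g (-((m : ℤ) + 1)) :=
    hs.summable.comp_injective fun a b hab => by
      rw [neg_inj, add_left_inj] at hab
      exact_mod_cast hab
  have hs2 : Summable fun m : ℕ => g (m : ℤ) := hs.summable.comp_injective Nat.cast_injective
  have hs3 : Summable fun m : ℕ => g ((m + n : ℕ) : ℤ) :=
    (summable_nat_add_iff (f := fun m : ℕ => g (m : ℤ)) n).2 hs2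
  have htotal := tsum_of_nat_of_neg_add_one (f := g) hs2 hs1
  rw [hs.tsum_eq, ← hs2.sum_add_tsum_nat_add n] at htotal
  simp only [hg, hmid, hneg, hpos] at hs1 hs3 htotal
  refine ⟨?_, ?_, ?_⟩
  · exact (summable_pnat_iff_summable_succ
      (f := fun m : ℕ => |h (-(m : ℤ)) * finStepCoeff x n m k|)).2 hs1.abs
  · exact (summable_pnat_iff_summable_succ
      (f := fun m : ℕ => |h ((n : ℤ) - 1 + (m : ℤ)) * finStepCoeff x n m (n + 1 - k)|)).2 hs3.abs
  · rw [tsum_pnat_eq_tsum_succ (f := fun m : ℕ => h (-(m : ℤ)) * finStepCoeff x n m k),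
      tsum_pnat_eq_tsum_succ
        (f := fun m : ℕ => h ((n : ℤ) - 1 + (m : ℤ)) * finStepCoeff x n m (n + 1 - k)), htotal]
    ring

end Formulas

/-! ### Uniform convergence and power bounds for slowly varying functions -/

section SlowVariation

/-- The uniform convergence theorem for slowly varying functions, in additive form. -/
theorem exists_forall_abs_sub_le_of_tendsto_translate {f : ℝ → ℝ} (hf : Measurable f)
    (hlim : ∀ v, Tendsto (fun u => f (u + v) - f u) atTop (𝓝 0)) {ε : ℝ} (hε : 0 < ε) :
    ∃ U, ∀ u ≥ U, ∀ v ∈ Set.Icc (0 : ℝ) 1, |f (u + v) - f u| ≤ ε := by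
  by_contra! hcon
  choose u hu v hv huv using fun n : ℕ => hcon n
  have hu' : Tendsto u atTop atTop := tendsto_atTop_mono hu tendsto_natCast_atTop_atTop
  have huv' : Tendsto (fun n => u n + v n) atTop atTop :=
    tendsto_atTop_mono (fun n => le_add_of_nonneg_right (hv n).1) hu'
  -- Pointwise convergence on a set of finite measure implies convergence in measure; this is where
  -- measurability enters.
  have key : ∀ a : ℕ → ℝ, Tendsto a atTop atTop →
      Tendsto (fun n => volume ({w | ε / 2 ≤ ‖f (a n + w) - f (a n) - 0‖} ∩ Set.Icc (0 : ℝ) 2))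
        atTop (𝓝 0) := by
    intro a ha
    have h1 : TendstoInMeasure (volume.restrict (Set.Icc (0 : ℝ) 2))
        (fun n w => f (a n + w) - f (a n)) atTop fun _ => 0 := by
      refine tendstoInMeasure_of_tendsto_ae (fun n => ?_) (Eventually.of_forall fun w => ?_)
      · exact Measurable.aestronglyMeasurable (by fun_prop)
      · exact (hlim w).comp ha
    have h2 := tendstoInMeasure_iff_norm.1 h1 (ε / 2) (half_pos hε)
    refine h2.congr fun n => ?_
    rw [Measure.restrict_apply]
    exact measurableSet_le measurable_const (by fun_prop)
  have hA := (key u hu').eventually_lt_const (show (0 : ENNReal) < 2⁻¹ by simp)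
  have hB := (key _ huv').eventually_lt_const (show (0 : ENNReal) < 2⁻¹ by simp)
  obtain ⟨n, hAn, hBn⟩ := (hA.and hB).exists
  set A := {w | ε / 2 ≤ ‖f (u n + w) - f (u n) - 0‖} ∩ Set.Icc (0 : ℝ) 2 with hAdef
  set B := {w | ε / 2 ≤ ‖f (u n + v n + w) - f (u n + v n) - 0‖} ∩ Set.Icc (0 : ℝ) 2 with hBdef
  -- Compare `f (u n)` and `f (u n + v n)` through the common point `u n + w`: one of the two
  -- increments must be large. An interval of length 1 is thus covered by two sets of measure below
  -- `1/2`.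
  have hcover : Set.Icc (1 : ℝ) 2 ⊆ A ∪ (fun w => w + -v n) ⁻¹' B := by
    intro w hw
    by_contra hnot
    rw [Set.mem_union, not_or] at hnot
    have h1 : ‖f (u n + w) - f (u n) - 0‖ < ε / 2 := by
      by_contra! h
      exact hnot.1 ⟨h, by linarith [hw.1], hw.2⟩
    have h2 : ‖f (u n + v n + (w + -v n)) - f (u n + v n) - 0‖ < ε / 2 := by
      by_contra! h
      exact hnot.2 ⟨h, by linarith [hw.1, (hv n).2], by linarith [hw.2, (hv n).1]⟩
    rw [show u n + v n + (w + -v n) = u n + w by ring] at h2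
    have h3 := huv n
    rw [sub_zero, Real.norm_eq_abs, abs_lt] at h1 h2
    rw [lt_abs] at h3
    rcases h3 with h3 | h3 <;> linarith [h1.1, h1.2, h2.1, h2.2]
  have h1 := (measure_mono hcover).trans (measure_union_le (μ := volume) _ _)
  rw [measure_preimage_add_right, Real.volume_Icc] at h1
  have h2 := h1.trans_lt (ENNReal.add_lt_add hAn hBn)
  rw [ENNReal.inv_two_add_inv_two] at h2
  norm_num at h2

/-- Beyond `U` each step of length at most 1 changes `f` by at most `ε`; chaining steps gives linear
growth with slope `ε`. -/
theorem exists_forall_abs_le_of_tendsto_translate {f : ℝ → ℝ} (hf : Measurable f)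
    (hlim : ∀ v, Tendsto (fun u => f (u + v) - f u) atTop (𝓝 0)) {ε : ℝ} (hε : 0 < ε) :
    ∃ U C, ∀ u ≥ U, |f u| ≤ C + ε * u := by
  obtain ⟨U, hU⟩ := exists_forall_abs_sub_le_of_tendsto_translate hf hlim hε
  have h1 : ∀ k : ℕ, ∀ v ∈ Set.Icc (0 : ℝ) 1, |f (U + v + k) - f U| ≤ ε * (k + 1) := by
    intro k v hv
    induction k with
    | zero => simpa using hU U le_rfl v hv
    | succ k ih =>
      have h2 := hU (U + v + k) (by linarith [hv.1, (k.cast_nonneg : (0 : ℝ) ≤ k)]) 1 (by simp)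
      push_cast
      rw [← add_assoc]
      calc |f (U + v + k + 1) - f U|
          ≤ |f (U + v + k + 1) - f (U + v + k)| + |f (U + v + k) - f U| := abs_sub_le _ _ _
        _ ≤ ε * (k + 1 + 1) := by linarith
  refine ⟨U, |f U| + ε * (1 - U), fun u hu => ?_⟩
  have h2 := Nat.floor_le (sub_nonneg.2 hu)
  have h3 := Nat.lt_floor_add_one (u - U)
  have h4 := h1 ⌊u - U⌋₊ (u - U - ⌊u - U⌋₊) ⟨by linarith, by linarith⟩
  rw [show U + (u - U - (⌊u - U⌋₊ : ℝ)) + ⌊u - U⌋₊ = u by ring] at h4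
  have h5 : ε * (⌊u - U⌋₊ + 1) ≤ ε * (u - U + 1) := by gcongr
  have h6 := abs_sub_abs_le_abs_sub (f u) (f U)
  linarith

theorem IsSlowlyVarying.exists_abs_log_le {l : ℝ≥0 → ℝ} (hl : IsSlowlyVarying l) {δ : ℝ}
    (hδ : 0 < δ) : ∃ C, ∀ᶠ j : ℕ in atTop, |Real.log (l j)| ≤ C + δ * Real.log j := by
  -- Logarithmic coordinates turn multiplicative slow variation into vanishing increments.
  set f : ℝ → ℝ := fun u => Real.log (l (Real.exp u).toNNReal) with hfdef
  have hf : Measurable f := by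
    have := hl.measurable
    fun_prop
  have hlim : ∀ v, Tendsto (fun u => f (u + v) - f u) atTop (𝓝 0) := by
    intro v
    have h1 : Tendsto (fun u : ℝ => (Real.exp u).toNNReal) atTop atTop :=
      tendsto_real_toNNReal_atTop.comp Real.tendsto_exp_atTop
    have h2 := (hl.tendsto (Real.exp v).toNNReal (by simp [Real.exp_pos])).comp h1
    have h3 := h2.log one_ne_zero
    rw [Real.log_one] at h3
    refine h3.congr fun u => ?_
    simp only [Function.comp_apply, hfdef]
    rw [Real.log_div (hl.pos _).ne' (hl.pos _).ne', ← Real.toNNReal_mul (Real.exp_pos _).le,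
      ← Real.exp_add, add_comm v u]
  obtain ⟨U, C, hC⟩ := exists_forall_abs_le_of_tendsto_translate hf hlim hδ
  refine ⟨C, ?_⟩
  filter_upwards [(Real.tendsto_log_atTop.comp tendsto_natCast_atTop_atTop).eventually_ge_atTop U,
    eventually_gt_atTop 0] with j hj hj0
  have := hC _ hj
  simpa only [hfdef, Function.comp_apply, Real.exp_log (Nat.cast_pos.2 hj0 : (0 : ℝ) < j),
    Real.toNNReal_natCast] using this

theorem IsSlowlyVarying.isBigO_rpow {l : ℝ≥0 → ℝ} (hl : IsSlowlyVarying l) {δ : ℝ} (hδ : 0 < δ) :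
    (fun j : ℕ => l j) =O[atTop] fun j : ℕ => (j : ℝ) ^ δ := by
  obtain ⟨C, hC⟩ := hl.exists_abs_log_le hδ
  refine IsBigO.of_bound (Real.exp C) ?_
  filter_upwards [hC, eventually_gt_atTop 0] with j hj hj0
  have hj' : (0 : ℝ) < j := Nat.cast_pos.2 hj0
  rw [Real.norm_of_nonneg (hl.pos _).le, Real.norm_of_nonneg (by positivity),
    Real.rpow_def_of_pos hj', ← Real.exp_add, ← Real.log_le_iff_le_exp (hl.pos _), mul_comm _ δ]
  exact (le_abs_self _).trans hj

theorem IsSlowlyVarying.isBigO_one_div_rpow {l : ℝ≥0 → ℝ} (hl : IsSlowlyVarying l) {δ : ℝ}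
    (hδ : 0 < δ) : (fun j : ℕ => 1 / l j) =O[atTop] fun j : ℕ => (j : ℝ) ^ δ := by
  obtain ⟨C, hC⟩ := hl.exists_abs_log_le hδ
  refine IsBigO.of_bound (Real.exp C) ?_
  filter_upwards [hC, eventually_gt_atTop 0] with j hj hj0
  have hj' : (0 : ℝ) < j := Nat.cast_pos.2 hj0
  have hlj := hl.pos j
  rw [Real.norm_of_nonneg (by positivity), Real.norm_of_nonneg (by positivity),
    Real.rpow_def_of_pos hj', ← Real.exp_add, ← Real.log_le_iff_le_exp (by positivity),
    mul_comm _ δ, one_div, Real.log_inv]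
  exact (neg_le_abs _).trans hj

/-- A sequence of order `j ^ s`, `s ≤ 0`, is bounded by a multiple of `(j + 1) ^ s`. -/
theorem exists_abs_le_of_isBigO_rpow {c : ℕ → ℝ} {s : ℝ} (hs : s ≤ 0)
    (h : c =O[atTop] fun j : ℕ => (j : ℝ) ^ s) :
    ∃ C, 0 ≤ C ∧ ∀ j, |c j| ≤ C * ((j : ℝ) + 1) ^ s := by
  have h1 : (fun j : ℕ => (j : ℝ) ^ s) =O[atTop] fun j : ℕ => ((j : ℝ) + 1) ^ s := by
    refine IsBigO.of_bound ((2⁻¹ : ℝ) ^ s) ?_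
    filter_upwards [eventually_ge_atTop 1] with j hj
    have hj' : (1 : ℝ) ≤ j := by exact_mod_cast hj
    rw [Real.norm_of_nonneg (by positivity), Real.norm_of_nonneg (by positivity),
      ← Real.mul_rpow (by norm_num) (by positivity)]
    exact Real.rpow_le_rpow_of_nonpos (by positivity) (by linarith) hs
  obtain ⟨C, hC0, hC⟩ := bound_of_isBigO_nat_atTop (h.trans h1)
  refine ⟨C, hC0.le, fun j => ?_⟩
  have hj : (0 : ℝ) < ((j : ℝ) + 1) ^ s := by positivity
  simpa only [Real.norm_eq_abs, abs_of_pos hj] using hC hj.ne'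

end SlowVariation

/-! ### Sums and convolutions of powers -/

section PowerSums

theorem sum_range_rpow_neg_le {a : ℝ} (h0 : 0 ≤ a) (h1 : a < 1) (m : ℕ) :
    ∑ l ∈ Finset.range m, ((l : ℝ) + 1) ^ (-a) ≤ (m : ℝ) ^ (1 - a) / (1 - a) := by
  induction m with
  | zero => simp [Real.zero_rpow (sub_pos.2 h1).ne']
  | succ m ih =>
    rw [Finset.sum_range_succ]
    refine (add_le_add_left ih _).trans ?_
    have ha : 0 < 1 - a := sub_pos.2 h1
    have hm : (0 : ℝ) < (m : ℝ) + 1 := by positivity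
    -- Bernoulli's inequality for an exponent in `(0, 1]` bounds the new term by the increment of
    -- the right-hand side.
    have h2 : (1 + -((m : ℝ) + 1)⁻¹) ^ (1 - a) ≤ 1 + (1 - a) * -((m : ℝ) + 1)⁻¹ :=
      rpow_one_add_le_one_add_mul_self
        (neg_le_neg (inv_le_one_of_one_le₀ (by linarith [(m.cast_nonneg : (0 : ℝ) ≤ m)])))
        ha.le (by linarith)
    have h3 : (m : ℝ) = (m + 1) * (1 + -((m : ℝ) + 1)⁻¹) := by
      field_simp
      ring
    have h4 : (m : ℝ) ^ (1 - a) = ((m : ℝ) + 1) ^ (1 - a) * (1 + -((m : ℝ) + 1)⁻¹) ^ (1 - a) := by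
      rw [← Real.mul_rpow hm.le, ← h3]
      by_contra hneg
      push Not at hneg
      have : ((m : ℝ) + 1)⁻¹ ≤ 1 :=
        inv_le_one_of_one_le₀ (by linarith [(m.cast_nonneg : (0 : ℝ) ≤ m)])
      linarith
    have h5 : ((m : ℝ) + 1) ^ (-a) = ((m : ℝ) + 1) ^ (1 - a) * ((m : ℝ) + 1)⁻¹ := by
      rw [← Real.rpow_neg_one, ← Real.rpow_add hm]
      congr 1
      ring
    rw [h4, h5]
    push_cast
    rw [div_add' _ _ _ ha.ne']
    gcongr
    have h6 : (0 : ℝ) ≤ ((m : ℝ) + 1) ^ (1 - a) := by positivity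
    nlinarith [mul_le_mul_of_nonneg_left h2 h6]

theorem sum_range_rpow_tail_le {b : ℝ} (hb : 0 < b) (r N : ℕ) :
    ∑ k ∈ Finset.range N, ((r + k + 1 : ℕ) + 1 : ℝ) ^ (-1 - b) ≤ ((r : ℝ) + 1) ^ (-b) / b := by
  -- The bound is strengthened to a telescoping difference so that the induction closes.
  suffices ∑ k ∈ Finset.range N, ((r + k + 1 : ℕ) + 1 : ℝ) ^ (-1 - b) ≤
      (((r : ℝ) + 1) ^ (-b) - ((r : ℝ) + N + 1) ^ (-b)) / b by
    refine this.trans ?_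
    gcongr
    exact sub_le_self _ (by positivity)
  induction N with
  | zero => simp
  | succ N ih =>
    rw [Finset.sum_range_succ]
    refine (add_le_add_left ih _).trans ?_
    push_cast
    set y : ℝ := (r : ℝ) + N + 1 with hy
    have hy0 : 0 < y := by positivity
    rw [show (r : ℝ) + (N + 1) + 1 = y + 1 by ring]
    have h1 : 1 + b * (y + 1)⁻¹ ≤ (y / (y + 1)) ^ (-b) := by
      have h2 : y / (y + 1) ≤ Real.exp (-(y + 1)⁻¹) := by
        refine le_trans (le_of_eq ?_) (Real.add_one_le_exp _)
        field_simp
        ring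
      have h3 : Real.exp (-(y + 1)⁻¹) ^ (-b) ≤ (y / (y + 1)) ^ (-b) :=
        Real.rpow_le_rpow_of_nonpos (by positivity) h2 (by linarith)
      refine le_trans ?_ h3
      rw [← Real.exp_mul, add_comm]
      refine le_trans (le_of_eq ?_) (Real.add_one_le_exp _)
      ring
    have h4 : y ^ (-b) = (y / (y + 1)) ^ (-b) * (y + 1) ^ (-b) := by
      rw [← Real.mul_rpow (by positivity) (by positivity)]
      congr 1
      field_simp
    have h5 : (y + 1) ^ (-1 - b) = (y + 1)⁻¹ * (y + 1) ^ (-b) := by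
      rw [← Real.rpow_neg_one, ← Real.rpow_add (by positivity)]
      congr 1
    have h6 : (0 : ℝ) ≤ (y + 1) ^ (-b) := by positivity
    rw [h5, div_add' _ _ _ hb.ne']
    gcongr
    nlinarith [mul_le_mul_of_nonneg_right h1 h6]

/-- Along an antidiagonal the two factors vary in opposite directions, so Chebyshev's sum inequality
bounds the convolution by the product of the two sums divided by `m + 1`. -/
theorem sum_antidiagonal_rpow_le {a b : ℝ} (ha0 : 0 ≤ a) (ha1 : a < 1) (hb0 : 0 ≤ b) (hb1 : b < 1)
    (m : ℕ) :
    ∑ p ∈ antidiagonal m, ((p.1 : ℝ) + 1) ^ (-a) * ((p.2 : ℝ) + 1) ^ (-b) ≤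
      ((1 - a) * (1 - b))⁻¹ * ((m : ℝ) + 1) ^ (1 - a - b) := by
  have h1 : AntivaryOn (fun p : ℕ × ℕ => ((p.1 : ℝ) + 1) ^ (-a))
      (fun p : ℕ × ℕ => ((p.2 : ℝ) + 1) ^ (-b)) (antidiagonal m) := by
    intro p hp q hq hlt
    rw [Finset.mem_coe, mem_antidiagonal] at hp hq
    have h2 : q.2 ≤ p.2 := by
      by_contra! h
      refine absurd hlt (not_lt.2 ?_)
      exact Real.rpow_le_rpow_of_nonpos (by positivity) (by gcongr) (by linarith)
    have h3 : p.1 ≤ q.1 := by lia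
    exact Real.rpow_le_rpow_of_nonpos (by positivity) (by gcongr) (by linarith)
  have h2 := h1.card_mul_sum_le_sum_mul_sum
  have h3 : ∑ p ∈ antidiagonal m, ((p.1 : ℝ) + 1) ^ (-a) ≤ ((m : ℝ) + 1) ^ (1 - a) / (1 - a) := by
    rw [Finset.Nat.sum_antidiagonal_eq_sum_range_succ_mk]
    simpa using sum_range_rpow_neg_le ha0 ha1 (m + 1)
  have h4 : ∑ p ∈ antidiagonal m, ((p.2 : ℝ) + 1) ^ (-b) ≤ ((m : ℝ) + 1) ^ (1 - b) / (1 - b) := by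
    rw [← Finset.Nat.sum_antidiagonal_swap, Finset.Nat.sum_antidiagonal_eq_sum_range_succ_mk]
    simpa using sum_range_rpow_neg_le hb0 hb1 (m + 1)
  have h5 : (0 : ℝ) < (m : ℝ) + 1 := by positivity
  have h6 := h2.trans (mul_le_mul h3 h4 (Finset.sum_nonneg fun p _ => by positivity)
    (div_nonneg (by positivity) (by linarith)))
  rw [Finset.Nat.card_antidiagonal, Nat.cast_succ] at h6
  have h7 : ((m : ℝ) + 1) ^ (1 - a) / (1 - a) * (((m : ℝ) + 1) ^ (1 - b) / (1 - b)) =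
      ((m : ℝ) + 1) * (((1 - a) * (1 - b))⁻¹ * ((m : ℝ) + 1) ^ (1 - a - b)) := by
    have h8 : ((m : ℝ) + 1) ^ (1 - a) * ((m : ℝ) + 1) ^ (1 - b) =
        ((m : ℝ) + 1) * ((m : ℝ) + 1) ^ (1 - a - b) := by
      rw [← Real.rpow_add h5]
      nth_rewrite 2 [← Real.rpow_one ((m : ℝ) + 1)]
      rw [← Real.rpow_add h5]
      congr 1
      ring
    rw [div_mul_div_comm, h8]
    field_simp
  rw [h7] at h6
  exact le_of_mul_le_mul_left h6 h5

end PowerSums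

/-! ### Bounds for the predictor coefficients and for square-summable combinations -/

section PredictorBounds

/-- The `ℓ¹` tails of a sequence. -/
noncomputable def absTail (c : ℕ → ℝ) (r : ℕ) : ℝ := ∑' k, |c (r + k + 1)|

theorem summable_abs_add {c : ℕ → ℝ} (hc : Summable fun j => |c j|) (r : ℕ) :
    Summable fun k => |c (r + k + 1)| :=
  hc.comp_injective (i := fun k => r + k + 1) fun a b h => by simpa using h

theorem absTail_nonneg (c : ℕ → ℝ) (r : ℕ) : 0 ≤ absTail c r :=
  tsum_nonneg fun _ => abs_nonneg _

theorem absTail_le_tsum {c : ℕ → ℝ} (hc : Summable fun j => |c j|) (r : ℕ) :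
    absTail c r ≤ ∑' j, |c j| :=
  tsum_comp_le_tsum_of_inj hc (fun _ => abs_nonneg _) (i := fun k => r + k + 1)
    fun a b h => by simpa using h

/-- In the double sum over `(r, k)` the term `|c (n + 1)|` occurs once for each pair with `r + k =
n`, that is, `n + 1` times. -/
theorem summable_absTail {c : ℕ → ℝ} (hc : Summable fun j : ℕ => (1 + (j : ℝ)) * |c j|) :
    Summable (absTail c) := by
  have h1 : Summable fun p : ℕ × ℕ => |c (p.1 + p.2 + 1)| := by
    refine Finset.HasAntidiagonal.sigmaAntidiagonalEquivProd.summable_iff.1 ?_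
    refine (summable_sigma_of_nonneg fun _ => abs_nonneg _).2
      ⟨fun n => (hasSum_fintype _).summable, ?_⟩
    refine Summable.of_nonneg_of_le (fun n => tsum_nonneg fun _ => abs_nonneg _) (fun n => ?_)
      (hc.comp_injective (add_left_injective 1))
    have h2 : ∀ p : antidiagonal n, |c ((p : ℕ × ℕ).1 + (p : ℕ × ℕ).2 + 1)| = |c (n + 1)| :=
      fun p => by rw [mem_antidiagonal.1 p.2]
    simp only [Function.comp_def, Finset.HasAntidiagonal.sigmaAntidiagonalEquivProd_apply, h2,
      tsum_fintype, Finset.sum_const, Finset.card_univ, Fintype.card_coe,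
      Finset.Nat.card_antidiagonal, nsmul_eq_mul]
    gcongr
    push_cast
    linarith
  exact ((summable_prod_of_nonneg fun _ => abs_nonneg _).1 h1).2

theorem absTail_le_of_abs_le {c : ℕ → ℝ} {C b : ℝ} (hC : 0 ≤ C) (hb : 0 < b)
    (h : ∀ j : ℕ, |c j| ≤ C * ((j : ℝ) + 1) ^ (-1 - b)) (r : ℕ) :
    absTail c r ≤ C / b * ((r : ℝ) + 1) ^ (-b) := by
  refine Real.tsum_le_of_sum_range_le (fun _ => abs_nonneg _) fun N => ?_
  refine (Finset.sum_le_sum fun k _ => h (r + k + 1)).trans ?_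
  rw [← Finset.mul_sum, div_mul_eq_mul_div, mul_div_assoc]
  exact mul_le_mul_of_nonneg_left (sum_range_rpow_tail_le hb r N) hC

theorem summable_abs_of_abs_le {c : ℕ → ℝ} {C b : ℝ} (hb : 0 < b)
    (h : ∀ j : ℕ, |c j| ≤ C * ((j : ℝ) + 1) ^ (-1 - b)) : Summable fun j => |c j| := by
  refine Summable.of_nonneg_of_le (fun _ => abs_nonneg _) h (Summable.mul_left C ?_)
  have h1 : Summable fun j : ℕ => (j : ℝ) ^ (-1 - b) := Real.summable_nat_rpow.2 (by linarith)
  simpa [Function.comp_def] using h1.comp_injective (add_left_injective 1)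

variable {E : Type*} [NormedAddCommGroup E] [InnerProductSpace ℝ E] [CompleteSpace E]

/-- A bound for the `ℓ¹` norm of the `m + 1`-step predictor coefficients. -/
noncomputable def predictorBound (x : ℤ → E) (m : ℕ) : ℝ :=
  ∑ p ∈ antidiagonal m, |maCoeff x p.1| * absTail (arCoeff x) p.2

theorem predictorBound_nonneg (x : ℤ → E) (m : ℕ) : 0 ≤ predictorBound x m :=
  Finset.sum_nonneg fun _ _ => mul_nonneg (abs_nonneg _) (absTail_nonneg _ _)

theorem tsum_abs_predictorCoeff_le {x : ℤ → E} (hφ : Summable fun j => |arCoeff x j|) (m : ℕ) :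
    ∑' k, |predictorCoeff x m k| ≤ predictorBound x m := by
  have h1 : HasSum (fun k => ∑ p ∈ antidiagonal m, |maCoeff x p.1| * |arCoeff x (p.2 + k + 1)|)
      (predictorBound x m) :=
    hasSum_sum fun p _ => (summable_abs_add hφ p.2).hasSum.mul_left _
  refine hasSum_le (fun k => ?_) (summable_predictorCoeff hφ m).hasSum h1
  refine (Finset.abs_sum_le_sum_abs _ _).trans (le_of_eq ?_)
  simp only [abs_mul]

theorem summable_mul_predictorCoeff {x : ℤ → E} (hφ : Summable fun j => |arCoeff x j|)
    {h : ℕ → ℝ} (hs : Summable fun m => |h m| * predictorBound x m) :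
    Summable fun p : ℕ × ℕ => |h p.1 * predictorCoeff x p.1 p.2| := by
  refine (summable_prod_of_nonneg fun _ => abs_nonneg _).2 ⟨fun m => ?_, ?_⟩
  · simp only [abs_mul]
    exact (summable_predictorCoeff hφ m).mul_left _
  · refine Summable.of_nonneg_of_le (fun m => tsum_nonneg fun _ => abs_nonneg _) (fun m => ?_) hs
    simp only [abs_mul, tsum_mul_left]
    exact mul_le_mul_of_nonneg_left (tsum_abs_predictorCoeff_le hφ m) (abs_nonneg _)

theorem predictorBound_le_of_summable {x : ℤ → E} (hψ : Summable fun j => |maCoeff x j|)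
    (hφ : Summable fun j => |arCoeff x j|) (m : ℕ) :
    predictorBound x m ≤ (∑' j, |maCoeff x j|) * ∑' j, |arCoeff x j| := by
  have h1 : ∑ p ∈ antidiagonal m, |maCoeff x p.1| ≤ ∑' j, |maCoeff x j| := by
    rw [Finset.Nat.sum_antidiagonal_eq_sum_range_succ_mk]
    exact hψ.sum_le_tsum _ fun _ _ => abs_nonneg _
  refine (Finset.sum_le_sum fun p _ => mul_le_mul_of_nonneg_left (absTail_le_tsum hφ p.2)
    (abs_nonneg (maCoeff x p.1))).trans ?_
  rw [← Finset.sum_mul]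
  exact mul_le_mul_of_nonneg_right h1 (tsum_nonneg fun _ => abs_nonneg _)

theorem summable_predictorBound {x : ℤ → E} (hψ : Summable fun j => |maCoeff x j|)
    (hφ : Summable fun j : ℕ => (1 + (j : ℝ)) * |arCoeff x j|) : Summable (predictorBound x) := by
  have h1 : Summable fun p : ℕ × ℕ => |maCoeff x p.1| * absTail (arCoeff x) p.2 :=
    Summable.mul_of_nonneg hψ (summable_absTail hφ) (fun _ => abs_nonneg _) (absTail_nonneg _)
  exact summable_sum_mul_antidiagonal_of_summable_mul (f := fun j => |maCoeff x j|) h1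

/-- Without slowly varying factors the exponents `-(1 - d)` of `ψ` and `-d` of the tails of `φ`
would convolve to exponent 0. Conceding `d / 2` in each gives exponent `d`, exactly the weight put
on `h`. -/
theorem exists_predictorBound_le_rpow {x : ℤ → E} {d C₁ C₂ : ℝ} (hd0 : 0 < d) (hd : d < 1 / 2)
    (hC₁ : 0 ≤ C₁) (hC₂ : 0 ≤ C₂)
    (hψ : ∀ j : ℕ, |maCoeff x j| ≤ C₁ * ((j : ℝ) + 1) ^ (-(1 - 3 * d / 2)))
    (hφ : ∀ j : ℕ, |arCoeff x j| ≤ C₂ * ((j : ℝ) + 1) ^ (-1 - d / 2)) :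
    ∃ C, 0 ≤ C ∧ ∀ m : ℕ, predictorBound x m ≤ C * ((m : ℝ) + 1) ^ d := by
  have hK : 0 ≤ ((1 - (1 - 3 * d / 2)) * (1 - d / 2))⁻¹ :=
    inv_nonneg.2 (mul_nonneg (by linarith) (by linarith))
  refine ⟨C₁ * (C₂ / (d / 2)) * ((1 - (1 - 3 * d / 2)) * (1 - d / 2))⁻¹, by positivity,
    fun m => ?_⟩
  have h1 := sum_antidiagonal_rpow_le (a := 1 - 3 * d / 2) (b := d / 2) (by linarith)
    (by linarith) (by linarith) (by linarith) m
  rw [show 1 - (1 - 3 * d / 2) - d / 2 = d by ring] at h1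
  rw [mul_assoc _ _ (_ ^ d)]
  refine le_trans ?_ (mul_le_mul_of_nonneg_left h1 (by positivity))
  rw [Finset.mul_sum]
  refine Finset.sum_le_sum fun p _ => ?_
  calc |maCoeff x p.1| * absTail (arCoeff x) p.2
      ≤ (C₁ * ((p.1 : ℝ) + 1) ^ (-(1 - 3 * d / 2))) *
        (C₂ / (d / 2) * ((p.2 : ℝ) + 1) ^ (-(d / 2))) :=
        mul_le_mul (hψ _) (absTail_le_of_abs_le hC₂ (by linarith) hφ _) (absTail_nonneg _ _)
          (by positivity)
    _ = _ := by ring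

theorem LongMemory.exists_coeff_le {x : ℤ → E} {d : ℝ} (hd0 : 0 < d) (hd : d < 1 / 2)
    (h : LongMemory x d) :
    (∃ C, 0 ≤ C ∧ ∀ j : ℕ, |maCoeff x j| ≤ C * ((j : ℝ) + 1) ^ (-(1 - 3 * d / 2))) ∧
      ∃ C, 0 ≤ C ∧ ∀ j : ℕ, |arCoeff x j| ≤ C * ((j : ℝ) + 1) ^ (-1 - d / 2) := by
  obtain ⟨-, l, hl, hψ, hφ⟩ := h
  have hmul : ∀ s t : ℝ, (fun j : ℕ => (j : ℝ) ^ s * (j : ℝ) ^ t) =ᶠ[atTop]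
      fun j : ℕ => (j : ℝ) ^ (s + t) := fun s t => by
    filter_upwards [eventually_gt_atTop 0] with j hj
    rw [Real.rpow_add (Nat.cast_pos.2 hj)]
  constructor
  · refine exists_abs_le_of_isBigO_rpow (by linarith) (hψ.isBigO.trans ?_)
    have h1 := (isBigO_refl (fun j : ℕ => (j : ℝ) ^ (-(1 - d))) atTop).mul
      (hl.isBigO_rpow (half_pos hd0))
    rw [show -(1 - 3 * d / 2) = -(1 - d) + d / 2 by ring]
    exact h1.trans_eventuallyEq (hmul _ _)
  · refine exists_abs_le_of_isBigO_rpow (by linarith) (hφ.isBigO.trans ?_)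
    have h1 := ((isBigO_refl (fun j : ℕ => (j : ℝ) ^ (-(1 + d))) atTop).mul
      (hl.isBigO_one_div_rpow (half_pos hd0))).mul
        (isBigO_const_const (d * Real.sin (Real.pi * d) / Real.pi) (one_ne_zero (α := ℝ)) atTop)
    simp only [mul_one] at h1
    rw [show -1 - d / 2 = -(1 + d) + d / 2 by ring]
    exact h1.trans_eventuallyEq (hmul _ _)

theorem IsStationarySeq.hasSum_maCoeff {x : ℤ → E} (hx : IsStationarySeq x)
    (hp : IsPurelyNondeterministic x) (hψ : Summable fun j => |maCoeff x j|)
    (t : ℤ) : HasSum (fun j : ℕ => maCoeff x j • innovation x (t - j)) (x t) := by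
  have hs : Summable fun j : ℕ => maCoeff x j • innovation x (t - j) := by
    refine Summable.of_norm ((hψ.mul_right ‖innovation x 0‖).congr fun j => ?_)
    rw [norm_smul, hx.norm_innovation (t - j), Real.norm_eq_abs]
  set w := ∑' j : ℕ, maCoeff x j • innovation x (t - j) with hw
  have hmem : w ∈ pastSpan x t := by
    refine (isClosed_pastSpan x t).mem_of_tendsto hs.hasSum (Eventually.of_forall fun s => ?_)
    exact Submodule.sum_mem _ fun i _ => Submodule.smul_mem _ _
      (pastSpan_mono x (by lia) (innovation_mem x _))
  suffices x t - w = 0 by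
    rw [sub_eq_zero.1 this]
    exact hs.hasSum
  refine hp.eq_zero_of_inner_innovation (Submodule.sub_mem _ (mem_pastSpan x le_rfl) hmem)
    fun s hs' => ?_
  obtain ⟨n, rfl⟩ : ∃ n : ℕ, s = t - n := ⟨(t - s).toNat, by lia⟩
  have h1 : HasSum (fun j : ℕ => inner ℝ (maCoeff x j • innovation x (t - j))
      (innovation x (t - n))) (inner ℝ w (innovation x (t - n))) := by
    have := hs.hasSum.mapL (innerSL ℝ (innovation x (t - n)))
    simpa only [innerSL_apply_apply, real_inner_comm] using this
  have h2 := hasSum_single (f := fun j : ℕ => inner ℝ (maCoeff x j • innovation x (t - j))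
      (innovation x (t - n))) n fun j hj => by
    rw [real_inner_smul_left, innovation_inner_innovation x (by lia), mul_zero]
  rw [inner_sub_left, h1.unique h2, hx.inner_innovation_sub, real_inner_smul_left,
    real_inner_self_eq_norm_sq, hx.norm_innovation (t - n), sub_self]

theorem IsStationarySeq.norm_sum_smul_innovation_sq {ι : Type*} {x : ℤ → E}
    (hx : IsStationarySeq x) (s : Finset ι) (c : ι → ℝ) {t : ι → ℤ} (ht : Function.Injective t) :
    ‖∑ i ∈ s, c i • innovation x (t i)‖ ^ 2 = ‖innovation x 0‖ ^ 2 * ∑ i ∈ s, |c i| ^ 2 := by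
  classical
  rw [← real_inner_self_eq_norm_sq, sum_inner, Finset.mul_sum]
  refine Finset.sum_congr rfl fun i hi => ?_
  rw [inner_sum, Finset.sum_eq_single_of_mem i hi fun j _ hj => ?_]
  · rw [real_inner_smul_left, real_inner_smul_right, real_inner_self_eq_norm_sq,
      hx.norm_innovation, sq_abs]
    ring
  · rw [real_inner_smul_left, real_inner_smul_right,
      innovation_inner_innovation x fun h => hj (ht h).symm, mul_zero, mul_zero]

/-- A moving average with absolutely summable coefficients has bounded spectral density. -/
theorem IsStationarySeq.norm_sum_smul_le {ι : Type*} {x : ℤ → E} (hx : IsStationarySeq x)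
    (hp : IsPurelyNondeterministic x) (hψ : Summable fun j => |maCoeff x j|)
    (s : Finset ι) (c : ι → ℝ) {t : ι → ℤ} (ht : Function.Injective t) :
    ‖∑ i ∈ s, c i • x (t i)‖ ≤
      (∑' j, |maCoeff x j|) * (‖innovation x 0‖ * √(∑ i ∈ s, |c i| ^ 2)) := by
  have h1 : HasSum (fun j : ℕ => ∑ i ∈ s, c i • maCoeff x j • innovation x (t i - j))
      (∑ i ∈ s, c i • x (t i)) :=
    hasSum_sum fun i _ => (hx.hasSum_maCoeff hp hψ (t i)).const_smul (c i)
  rw [← h1.tsum_eq]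
  refine tsum_of_norm_bounded (hψ.hasSum.mul_right _) fun j => ?_
  -- At a fixed lag `j` the innovations are orthogonal, with the same `ℓ²` norm for every `j`; the
  -- triangle inequality over lags then costs only the `ℓ¹` norm of `ψ`.
  simp only [smul_comm _ (maCoeff x j)]
  rw [← Finset.smul_sum, norm_smul, Real.norm_eq_abs]
  refine mul_le_mul_of_nonneg_left (le_of_eq ?_) (abs_nonneg _)
  rw [← sq_eq_sq₀ (norm_nonneg _) (by positivity), mul_pow, Real.sq_sqrt (by positivity)]
  exact hx.norm_sum_smul_innovation_sq s c fun a b hab => ht (by simpa using hab)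

theorem IsStationarySeq.summable_smul_of_sq {ι : Type*} {x : ℤ → E} (hx : IsStationarySeq x)
    (hp : IsPurelyNondeterministic x) (hψ : Summable fun j => |maCoeff x j|)
    {c : ι → ℝ} (hc : Summable fun i => |c i| ^ 2) {t : ι → ℤ} (ht : Function.Injective t) :
    Summable fun i => c i • x (t i) := by
  rw [summable_iff_vanishing_norm]
  intro ε hε
  set K := (∑' j, |maCoeff x j|) * ‖innovation x 0‖ with hK
  have hK0 : 0 ≤ K := mul_nonneg (tsum_nonneg fun _ => abs_nonneg _) (norm_nonneg _)
  -- Dividing by `K + 1` avoids requiring `K` to be nonzero.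
  obtain ⟨s, hs⟩ := summable_iff_vanishing_norm.1 hc ((ε / (K + 1)) ^ 2) (by positivity)
  refine ⟨s, fun u hu => ?_⟩
  have h1 := hs u hu
  rw [Real.norm_of_nonneg (Finset.sum_nonneg fun _ _ => by positivity)] at h1
  have h2 : √(∑ i ∈ u, |c i| ^ 2) < ε / (K + 1) := (Real.sqrt_lt' (by positivity)).2 h1
  calc ‖∑ i ∈ u, c i • x (t i)‖ ≤ K * √(∑ i ∈ u, |c i| ^ 2) := by
        rw [hK, mul_assoc]
        exact hx.norm_sum_smul_le hp hψ u c ht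
    _ ≤ K * (ε / (K + 1)) := by gcongr
    _ < (K + 1) * (ε / (K + 1)) := by
        gcongr
        linarith
    _ = ε := by field_simp

theorem summable_sq_of_summable_abs {c : ℕ → ℝ} (hc : Summable fun k => |c k|) :
    Summable fun k => |c k| ^ 2 := by
  refine Summable.of_norm_bounded_eventually_nat hc ?_
  filter_upwards [hc.tendsto_atTop_zero.eventually_le_const one_pos] with k hk
  rw [Real.norm_of_nonneg (by positivity), sq]
  exact mul_le_of_le_one_left (abs_nonneg _) hk

end PredictorBounds

/-! ### Verification of the three sets of conditions -/

section Conditions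

variable {E : Type*} [NormedAddCommGroup E] [InnerProductSpace ℝ E] [CompleteSpace E]

/-- What the prediction formulas need: summable autoregressive coefficients, convergence of the
targets, and absolute convergence of the double series of predictors of the future part. -/
structure IsPredictable (x : ℤ → E) (h : ℤ → ℝ) : Prop where
  purelyNondeterministic : IsPurelyNondeterministic x
  summable_arCoeff : Summable fun j => |arCoeff x j|
  summable_target : ∀ n : ℤ, Summable fun k : ℤ => h k • x (n - k)
  summable_future :
    Summable fun p : ℕ × ℕ => |h (-((p.1 : ℤ) + 1)) * predictorCoeff x p.1 p.2|

theorem summable_of_rpow_mul {c : ℕ → ℝ} {α β : ℝ} (hαβ : α ≤ β)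
    (h : Summable fun j : ℕ => (1 + (j : ℝ)) ^ β * |c j|) :
    Summable fun j : ℕ => (1 + (j : ℝ)) ^ α * |c j| :=
  Summable.of_nonneg_of_le (fun j => by positivity) (fun j => mul_le_mul_of_nonneg_right
    (Real.rpow_le_rpow_of_exponent_le (by linarith [(j.cast_nonneg : (0 : ℝ) ≤ j)]) hαβ)
    (abs_nonneg _)) h

theorem ShortMemory.mono {x : ℤ → E} {α β : ℝ} (hαβ : α ≤ β) (h : ShortMemory x β) :
    ShortMemory x α :=
  ⟨h.1, summable_of_rpow_mul hαβ h.2.1, summable_of_rpow_mul hαβ h.2.2⟩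

theorem ShortMemory.summable_abs {x : ℤ → E} {α : ℝ} (hα : 0 ≤ α) (h : ShortMemory x α) :
    (Summable fun j => |maCoeff x j|) ∧ Summable fun j => |arCoeff x j| := by
  have h1 := h.mono hα
  simpa only [ShortMemory, Real.rpow_zero, one_mul] using h1.2

theorem neg_natCast_add_one_injective : Function.Injective fun m : ℕ => -((m : ℤ) + 1) :=
  fun a b hab => by simpa using hab

theorem summable_comp_neg_natCast {g : ℤ → ℝ} (hg : Summable g) :
    Summable fun m : ℕ => g (-((m : ℤ) + 1)) := by
  have h1 := hg.comp_injective neg_natCast_add_one_injective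
  simp only [Function.comp_def] at h1
  exact h1

theorem HSM1.isPredictable {x : ℤ → E} (hx : IsStationarySeq x) {h : ℤ → ℝ} (hH : HSM1 x h) :
    IsPredictable x h := by
  obtain ⟨⟨α, hα, hS⟩, hh⟩ := hH
  obtain ⟨hψ, hφ⟩ := hS.summable_abs hα
  refine ⟨hS.1, hφ, fun n => hx.summable_smul hh _, ?_⟩
  refine summable_mul_predictorCoeff hφ (h := fun m : ℕ => h (-((m : ℤ) + 1))) ?_
  refine Summable.of_nonneg_of_le (fun m => mul_nonneg (abs_nonneg _) (predictorBound_nonneg x m))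
    (fun m => ?_) ((summable_comp_neg_natCast hh).mul_right
      ((∑' j, |maCoeff x j|) * ∑' j, |arCoeff x j|))
  exact mul_le_mul_of_nonneg_left (predictorBound_le_of_summable hψ hφ m) (abs_nonneg _)

/-- The roles are reversed from `HSM1`: here `h` is merely bounded, by its `ℓ²` norm, and
`predictorBound` is summable. Convergence of the target uses the `ℓ²` bound for moving averages. -/
theorem HSM2.isPredictable {x : ℤ → E} (hx : IsStationarySeq x) {h : ℤ → ℝ} (hH : HSM2 x h) :
    IsPredictable x h := by
  obtain ⟨⟨α, hα, hS⟩, hh⟩ := hH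
  obtain ⟨hψ, hφ⟩ := hS.summable_abs (zero_le_one.trans hα)
  have hφ1 := (hS.mono hα).2.2
  simp only [Real.rpow_one] at hφ1
  refine ⟨hS.1, hφ, fun n => hx.summable_smul_of_sq hS.1 hψ hh sub_right_injective,
    ?_⟩
  have hbound : ∀ k, |h k| ≤ √(∑' k, |h k| ^ 2) := fun k =>
    Real.le_sqrt_of_sq_le (hh.le_tsum k fun _ _ => by positivity)
  refine summable_mul_predictorCoeff hφ (h := fun m : ℕ => h (-((m : ℤ) + 1))) ?_
  refine Summable.of_nonneg_of_le (fun m => mul_nonneg (abs_nonneg _) (predictorBound_nonneg x m))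
    (fun m => ?_) ((summable_predictorBound hψ hφ1).mul_left √(∑' k, |h k| ^ 2))
  exact mul_le_mul_of_nonneg_right (hbound _) (predictorBound_nonneg x m)

theorem summable_abs_of_summable_rpow_mul {h : ℤ → ℝ} {d : ℝ} (hd : 0 ≤ d)
    (hh : Summable fun k : ℤ => (1 + |(k : ℝ)|) ^ d * |h k|) : Summable fun k : ℤ => |h k| :=
  Summable.of_nonneg_of_le (fun _ => abs_nonneg _) (fun k => le_mul_of_one_le_left (abs_nonneg _)
    (Real.one_le_rpow (by linarith [abs_nonneg (k : ℝ)]) hd)) hh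

theorem HLM.isPredictable {x : ℤ → E} (hx : IsStationarySeq x) {h : ℤ → ℝ} (hH : HLM x h) :
    IsPredictable x h := by
  obtain ⟨d, hd0, hd, hL, hh⟩ := hH
  obtain ⟨⟨C₁, hC₁, hψ⟩, ⟨C₂, hC₂, hφ⟩⟩ := hL.exists_coeff_le hd0 hd
  have hφ' := summable_abs_of_abs_le (half_pos hd0) hφ
  obtain ⟨C, hC, hB⟩ := exists_predictorBound_le_rpow hd0 hd hC₁ hC₂ hψ hφ
  refine ⟨hL.1, hφ', fun n => hx.summable_smul (summable_abs_of_summable_rpow_mul hd0.le hh) _,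
    ?_⟩
  refine summable_mul_predictorCoeff hφ' (h := fun m : ℕ => h (-((m : ℤ) + 1))) ?_
  refine Summable.of_nonneg_of_le (fun m => mul_nonneg (abs_nonneg _) (predictorBound_nonneg x m))
    (fun m => ?_) ((summable_comp_neg_natCast hh).mul_left C)
  -- The index `m` stands for `k = -(m + 1)`, whose weight is `(m + 2) ^ d`.
  have h1 : ((m : ℝ) + 1) ^ d ≤ (1 + |((-((m : ℤ) + 1) : ℤ) : ℝ)|) ^ d := by
    refine Real.rpow_le_rpow (by positivity) ?_ hd0.le
    push_cast
    rw [abs_neg]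
    linarith [le_abs_self ((m : ℝ) + 1)]
  calc |h (-((m : ℤ) + 1))| * predictorBound x m
      ≤ |h (-((m : ℤ) + 1))| * (C * (1 + |((-((m : ℤ) + 1) : ℤ) : ℝ)|) ^ d) := by
        gcongr
        exact (hB m).trans (mul_le_mul_of_nonneg_left h1 hC)
    _ = C * ((1 + |((-((m : ℤ) + 1) : ℤ) : ℝ)|) ^ d * |h (-((m : ℤ) + 1))|) := by ring

/-- The future contribution to `ĥ` is thus always in `ℓ¹`, so `ĥ` inherits `ℓ¹` or `ℓ²` summability
from `h`. -/
theorem IsPredictable.summable_abs_future {x : ℤ → E} {h : ℤ → ℝ} (hP : IsPredictable x h) :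
    Summable fun k : ℕ => |∑' m : ℕ, h (-((m : ℤ) + 1)) * predictorCoeff x m k| :=
  hP.summable_future.of_abs.prod_symm.prod.abs

theorem IsPredictable.summable_abs_hHat {x : ℤ → E} (hx : IsStationarySeq x) (h0 : x 0 ≠ 0)
    {h : ℤ → ℝ} (hP : IsPredictable x h) (hh : Summable fun k : ℤ => |h k|) :
    Summable fun k : ℕ+ => |hHat x h k| := by
  refine (summable_pnat_iff_summable_succ (f := fun k => |hHat x h k|)).2 ?_
  simp only [hx.hHat_eq hP.purelyNondeterministic h0 hP.summable_arCoeff hP.summable_future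
    fun n _ => hP.summable_target n]
  exact Summable.of_nonneg_of_le (fun _ => abs_nonneg _) (fun _ => abs_add_le _ _)
    (hP.summable_abs_future.add (hh.comp_injective Nat.cast_injective))

theorem IsPredictable.summable_hHat_sq {x : ℤ → E} (hx : IsStationarySeq x) (h0 : x 0 ≠ 0)
    {h : ℤ → ℝ} (hP : IsPredictable x h) (hh : Summable fun k : ℤ => |h k| ^ 2) :
    Summable fun k : ℕ+ => |hHat x h k| ^ 2 := by
  refine (summable_pnat_iff_summable_succ (f := fun k => |hHat x h k| ^ 2)).2 ?_
  simp only [hx.hHat_eq hP.purelyNondeterministic h0 hP.summable_arCoeff hP.summable_future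
    fun n _ => hP.summable_target n]
  refine Summable.of_nonneg_of_le (fun _ => by positivity) (fun k => ?_)
    (((summable_sq_of_summable_abs hP.summable_abs_future).add
      (hh.comp_injective (i := fun k : ℕ => (k : ℤ)) Nat.cast_injective)).mul_left 2)
  simp only [Function.comp_apply, sq_abs]
  exact add_sq_le

end Conditions

/-! ### From the process to a stationary sequence in `L²` -/

section StationaryProcess

variable {Ω : Type*} [MeasurableSpace Ω]

theorem IsCenteredStationary.inner_toL2 {X : ℤ → Ω → ℝ} {P : Measure Ω} [IsProbabilityMeasure P]
    (hX : IsCenteredStationary X P) (s t : ℤ) :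
    inner ℝ (hX.toL2 s) (hX.toL2 t) = cov[X s, X t; P] := by
  rw [covariance_eq_sub (hX.memLp s) (hX.memLp t), hX.centered, hX.centered, mul_zero, sub_zero,
    L2.inner_def]
  refine integral_congr_ae ?_
  filter_upwards [(hX.memLp s).coeFn_toLp, (hX.memLp t).coeFn_toLp] with ω hs ht
  simp only [IsCenteredStationary.toL2, hs, ht, Pi.mul_apply]
  simp [mul_comm]

theorem IsCenteredStationary.isStationarySeq {X : ℤ → Ω → ℝ} {P : Measure Ω}
    [IsProbabilityMeasure P] (hX : IsCenteredStationary X P) : IsStationarySeq hX.toL2 :=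
  fun s t => by rw [hX.inner_toL2, hX.inner_toL2, hX.stationary]

theorem IsCenteredStationary.toL2_zero_ne_zero {X : ℤ → Ω → ℝ} {P : Measure Ω}
    [IsProbabilityMeasure P] (hX : IsCenteredStationary X P) (hvar : 0 < Var[X 0; P]) :
    hX.toL2 0 ≠ 0 := by
  rw [← covariance_self (hX.memLp 0).aestronglyMeasurable.aemeasurable, ← hX.inner_toL2] at hvar
  intro h
  rw [h, inner_zero_left] at hvar
  exact lt_irrefl _ hvar

end StationaryProcess

theorem theorem3p1 {Ω : Type*} [MeasurableSpace Ω] (P : Measure Ω) [IsProbabilityMeasure P]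
    (X : ℤ → Ω → ℝ) (hX : IsCenteredStationary X P) (hvar : 0 < Var[X 0; P]) (h : ℤ → ℝ)
    (hH : HSM1 hX.toL2 h ∨ HSM2 hX.toL2 h ∨ HLM hX.toL2 h) :
    -- the targets, and the four families of coefficients, are well defined:
    -- minimizers exist and are unique
    (∀ n : ℕ, 1 ≤ n → Summable (fun k : ℤ => h k • hX.toL2 (n - k))) ∧
    (∀ m n : ℕ, 1 ≤ m → 1 ≤ n → ∀ a : ℕ → ℝ,
      IsInfMinimizer hX.toL2 n (hX.toL2 (n + m)) a ↔
        ∀ k, 1 ≤ k → a k = stepCoeff hX.toL2 m k) ∧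
    (∀ m n : ℕ, 1 ≤ m → 1 ≤ n → ∀ a : ℕ → ℝ,
      IsFinMinimizer hX.toL2 n (hX.toL2 (n + m)) a ↔
        ∀ k ∈ Finset.Icc 1 n, a k = finStepCoeff hX.toL2 n m k) ∧
    (∀ n : ℕ, 1 ≤ n → ∀ a : ℕ → ℝ,
      IsInfMinimizer hX.toL2 n (target hX.toL2 h n) a ↔
        ∀ k, 1 ≤ k → a k = hHat hX.toL2 h k) ∧
    (∀ n : ℕ, 1 ≤ n → ∀ a : ℕ → ℝ,
      IsFinMinimizer hX.toL2 n (target hX.toL2 h n) a ↔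
        ∀ k ∈ Finset.Icc 1 n, a k = hHatFin hX.toL2 h n k) ∧
    -- the infinite-past coefficients
    (∀ k : ℕ, 1 ≤ k →
      Summable (fun m : ℕ+ => |h (-(m : ℤ)) * stepCoeff hX.toL2 m k|) ∧
      hHat hX.toL2 h k =
        (∑' m : ℕ+, h (-(m : ℤ)) * stepCoeff hX.toL2 m k) + h ((k : ℤ) - 1)) ∧
    -- the finite-past coefficients
    (∀ n : ℕ, 1 ≤ n → ∀ k ∈ Finset.Icc 1 n,
      Summable (fun m : ℕ+ => |h (-(m : ℤ)) * finStepCoeff hX.toL2 n m k|) ∧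
      Summable (fun m : ℕ+ =>
        |h ((n : ℤ) - 1 + (m : ℤ)) * finStepCoeff hX.toL2 n m (n + 1 - k)|) ∧
      hHatFin hX.toL2 h n k =
        (∑' m : ℕ+, h (-(m : ℤ)) * finStepCoeff hX.toL2 n m k) + h ((k : ℤ) - 1) +
          ∑' m : ℕ+, h ((n : ℤ) - 1 + (m : ℤ)) * finStepCoeff hX.toL2 n m (n + 1 - k)) ∧
    -- summability
    (HSM1 hX.toL2 h ∨ HLM hX.toL2 h → Summable (fun k : ℕ+ => |hHat hX.toL2 h k|)) ∧
    (HSM2 hX.toL2 h → Summable (fun k : ℕ+ => |hHat hX.toL2 h k| ^ 2)) := by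
  have hx := hX.isStationarySeq
  have h0 := hX.toL2_zero_ne_zero hvar
  have hP : IsPredictable hX.toL2 h := by
    rcases hH with hH | hH | hH
    exacts [hH.isPredictable hx, hH.isPredictable hx, hH.isPredictable hx]
  have hp := hP.purelyNondeterministic
  have hφ := hP.summable_arCoeff
  refine ⟨fun n _ => hP.summable_target n, fun m n hm hn a => ?_,
    fun m n _ _ a => hx.isFinMinimizer_iff_finCoeff hp h0 n _ a, fun n hn a => ?_,
    fun n _ a => hx.isFinMinimizer_iff_finCoeff hp h0 n _ a,
    fun k hk => hx.hHat_formula hp h0 hφ hP.summable_future (fun n _ => hP.summable_target n) hk,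
    fun n _ k hk => hx.hHatFin_formula hp h0 (hP.summable_target n) hk, ?_, fun hH2 =>
    hP.summable_hHat_sq hx h0 hH2.2⟩
  · obtain ⟨m, rfl⟩ := Nat.exists_eq_add_of_le' hm
    exact hx.isInfMinimizer_iff_infCoeff hp h0
      (fun n _ => hx.hasSum_predictorCoeff hp h0 hφ n m) hn a
  · exact hx.isInfMinimizer_iff_infCoeff hp h0 (fun n _ => hx.hasSum_starProjection_target hp h0 hφ
      hP.summable_future (hP.summable_target n)) hn a
  · rintro (hH1 | ⟨d, hd, _, _, hh⟩)
    · exact hP.summable_abs_hHat hx h0 hH1.2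
    · exact hP.summable_abs_hHat hx h0 (summable_abs_of_summable_rpow_mul hd.le hh)
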